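/- Let $\mathbb T^d=\mathbb R^d/\mathbb Z^d$ with the metric $d(\cdot,\cdot)$ induced by the Euclidean metric, let $|A|$ denote the diameter of $A\subseteq\mathbb T^d$, and let $d(A,B)=\inf\{d(x,y): x\in A,\,y\in B\}$. Let $\omega\in\mathbb T^d$ be totally irrational ($\sum_i k_i\omega_i\neq 0$ in $\mathbb R/\mathbb Z$ for every $k\in\mathbb Z^d\setminus\{0\}$) and Diophantine (there are $\mathscr C>0$, $\eta>1$ with $d(k\omega,0)\ge \mathscr C|k|^{-\eta}$ for all $k\in\mathbb Z\setminus\{0\}$). Let $X\subseteq\mathbb R$ be an interval with $[0,1]\subseteq X$, and let $f:\mathbb T^d\times X\to\mathbb T^d\times X$, $f(\theta,x)=(\theta+\omega,f_\theta(x))$, be a $\mathcal C^2$ map with monotone fibre maps $f_\theta:X\to X$. Put $\Gamma=\mathbb T^d\times[0,1]$. The map $f$ belongs to the class $\mathcal V$ if for all $\theta$: $f_\theta(0)\le 0$, $f_\theta(1)\le 1$, $f_\theta'>0$ and $f_\theta''<0$ on $[0,1]$, and if there are numbers $0<e<c<1$, with $C=[c,1]$ and $E=[0,e]$, a closed convex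 region $\mathcal I_0\subseteq\mathbb T^d$, $\alpha>1$, $p\ge\sqrt2$, $S>0$, integers $K_0\ge1$ and $\kappa\ge2$, integers $(M_n)_{n\ge0}$, and $c_0>0$ with the following properties. 1. $f_\theta(x)\in C$ for all $x\in[e,1]$ and $\theta\notin\mathcal I_0$. For all $\theta,\theta'\in\mathbb T^d$: $\alpha^{-p}|x-x'|\le|f_\theta(x)-f_\theta(x')|\le\alpha^{p}|x-x'|$ for $x,x'\in X$; $|f_\theta(x)-f_{\theta'}(x)|\le S\,d(\theta,\theta')$ for $x\in X$; $|f_\theta(x)-f_\theta(x')|\le\alpha^{-2/p}|x-x'|$ for $x,x'\in C$; $|f_\theta(x)-f_\theta(x')|\ge\alpha^{2/p}|x-x'|$ for $x,x'\in E$. 2. With $K_n=K_0\kappa^n$, $b_0=1$, $b_{n+1}=(1-1/K_n)b_n$ and $b=\lim_{n\to\infty} b_n$, one has $b>\sqrt{(p^2+1)/(p^2+2)}$, $M_0\ge2$ and $M_{n+1}\in[K_nM_n,\,2K_nM_n-2]$ for all $n\ge0$. 3. Define recursively, with $\pi$ the projection to $\mathbb T^d$, $$\mathcal I_{n+1}=\pi\Big(f^{M_n-1}\big((\mathcal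 I_n-(M_n-1)\omega)\times C\big)\cap f^{-(M_n+1)}\big((\mathcal I_n+(M_n+1)\omega)\times E\big)\Big)\qquad(n\ge0),$$ and put $\mathcal V_n=\bigcup_{j=0}^n\bigcup_{l=1}^{M_j+1}(\mathcal I_j+l\omega)$, $\mathcal W_n=\bigcup_{j=0}^n\bigcup_{l=-(M_j-1)}^{0}(\mathcal I_j+l\omega)$, $\mathcal V_{-1}=\mathcal W_{-1}=\emptyset$, and $\varepsilon_n=c_0\alpha^{-M_{n-1}b/(2p)}$ with $M_{-1}=0$. Then for all $j\ge0$: $\mathcal I_j\ne\emptyset$, $d\big(\mathcal I_j,\bigcup_{k=1}^{2K_jM_j}(\mathcal I_j+k\omega)\big)>\varepsilon_j$, and $\big((\mathcal I_j-(M_j-1)\omega)\cup(\mathcal I_j+(M_j+1)\omega)\big)\cap(\mathcal V_{j-1}\cup\mathcal W_{j-1})=\emptyset$; moreover $|\mathcal I_n|<\varepsilon_n$ for all $n\ge1$. Let $\Lambda=\bigcap_{n\in\mathbb Z}f^n(\Gamma)$ be the maximal $f$-invariant subset of $\Gamma$, where $f^{-n}(\Gamma)$ is the preimage of $\Gamma$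 under $f^n$, let $\Lambda_\theta=\{x\in[0,1]:(\theta,x)\in\Lambda\}$, and let $\phi^+(\theta)=\sup\Lambda_\theta$. An invariant graph is a measurable function $\phi:\mathbb T^d\to X$ with $f_\theta(\phi(\theta))=\phi(\theta+\omega)$ for all $\theta\in\mathbb T^d$. **Corollary.** Let $f\in\mathcal V$. Then $\Lambda_\theta\neq\emptyset$ for all $\theta$, and $\phi^+$ is an upper semi-continuous invariant graph. If $\phi$ is an upper semi-continuous invariant graph with $\phi=\phi^+$ Lebesgue-almost everywhere, then $\phi=\phi^+$ everywhere; that is, $\phi^+$ is the unique upper semi-continuous invariant graph in its almost-everywhere equivalence class. Moreover, $$\phi^+\big(\overline{B_r(\theta)}\big)\subseteq\overline{\phi^+\big(B_r(\theta)\big)}$$ for all $\theta\in\mathbb T^d$ and all $r>0$, where $B_r(\theta)$ is the open ball of radius $r$ centred at $\theta$. -/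

import Mathlib

open Set Filter Topology MeasureTheory

namespace QPF

/-- The torus `𝕋^d = ℝ^d / ℤ^d` with its group structure and the metric induced by the Euclidean
metric of `ℝ^d` (each coordinate difference is measured by its distance to the nearest integer). -/
abbrev Torus (d : ℕ) : Type := PiLp 2 (fun _ : Fin d => UnitAddCircle)

/-- The canonical projection `ℝ^d → 𝕋^d`. -/
noncomputable def proj (d : ℕ) (v : EuclideanSpace ℝ (Fin d)) : Torus d :=
  WithLp.toLp 2 (fun i => ((v i : ℝ) : UnitAddCircle))

/-- Lebesgue (probability) measure on `𝕋^d`: the product of the normalised measures of the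
circles. -/
noncomputable def leb (d : ℕ) : Measure (Torus d) :=
  (volume : Measure (Fin d → UnitAddCircle)).map (WithLp.toLp 2)

/-- `ω` is totally irrational: `k · ω ≠ 0` in `ℝ/ℤ` for every non-zero integer vector `k`. -/
def TotallyIrrational {d : ℕ} (ω : Torus d) : Prop :=
  ∀ k : Fin d → ℤ, k ≠ 0 → ∑ i, k i • ω i ≠ 0

/-- `ω` is Diophantine: `d(kω, 0) ≥ C |k|^{-η}` for some `C > 0`, `η > 1` and all `k ∈ ℤ \ {0}`. -/
def Diophantine {d : ℕ} (ω : Torus d) : Prop :=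
  ∃ C η : ℝ, 0 < C ∧ 1 < η ∧ ∀ k : ℤ, k ≠ 0 → C * |(k : ℝ)| ^ (-η) ≤ dist (k • ω) 0

/-- The skew product `(θ, x) ↦ (θ + ω, f_θ(x))`. The fibre maps are given by a total function
`f`; only its values on `𝕋^d × X` matter in what follows. -/
def skew {d : ℕ} (ω : Torus d) (f : Torus d → ℝ → ℝ) (q : Torus d × ℝ) : Torus d × ℝ :=
  (q.1 + ω, f q.1 q.2)

/-- The class of `C²` quasiperiodically forced monotone interval maps on `𝕋^d × X` with rotation
vector `ω`, where `X ⊆ ℝ` is an interval that contains `[0,1]`. -/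
structure IsQpfMap {d : ℕ} (ω : Torus d) (X : Set ℝ) (f : Torus d → ℝ → ℝ) : Prop where
  totallyIrrational : TotallyIrrational ω
  interval : X.OrdConnected
  unit_subset : Icc (0 : ℝ) 1 ⊆ X
  mapsTo : ∀ θ, MapsTo (f θ) X X
  monotone : ∀ θ, MonotoneOn (f θ) X
  smooth : ContDiffOn ℝ 2
    (fun q : EuclideanSpace ℝ (Fin d) × ℝ => f (proj d q.1) q.2) (univ ×ˢ X)

/-- `f_θ(0) ≤ 0`, `f_θ(1) ≤ 1`, and `f_θ' > 0`, `f_θ'' < 0` on `[0,1]`, for all `θ`. Derivatives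
are taken in `X`, hence are one-sided at end points of `X`. -/
structure IsMonotoneConcave {d : ℕ} (X : Set ℝ) (f : Torus d → ℝ → ℝ) : Prop where
  zero_le : ∀ θ, f θ 0 ≤ 0
  one_le : ∀ θ, f θ 1 ≤ 1
  deriv_pos : ∀ θ, ∀ x ∈ Icc (0 : ℝ) 1, 0 < derivWithin (f θ) X x
  deriv2_neg : ∀ θ, ∀ x ∈ Icc (0 : ℝ) 1, derivWithin (derivWithin (f θ) X) X x < 0

/-- The constants (and the first critical region) that have to be chosen for the multiscale
conditions. No property is imposed here. -/
structure Constants (d : ℕ) where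
  /-- left end point of the interval of contraction `C = [c,1]` -/
  c : ℝ
  /-- right end point of the interval of expansion `E = [0,e]` -/
  e : ℝ
  /-- the first critical region -/
  I₀ : Set (Torus d)
  α : ℝ
  p : ℝ
  S : ℝ
  K₀ : ℕ
  κ : ℕ
  b : ℝ
  M : ℕ → ℕ
  c₀ : ℝ

namespace Constants

variable {d : ℕ} (P : Constants d)

/-- `C = [c,1]`. -/
def C : Set ℝ := Icc P.c 1

/-- `E = [0,e]`. -/
def E : Set ℝ := Icc 0 P.e

/-- `K_n = K₀ κ^n`. -/
def K (n : ℕ) : ℕ := P.K₀ * P.κ ^ n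

/-- `b_0 = 1`, `b_{n+1} = (1 - 1/K_n) b_n`. -/
noncomputable def bSeq : ℕ → ℝ
  | 0 => 1
  | n + 1 => (1 - 1 / (P.K n : ℝ)) * bSeq n

/-- `M_{n-1}`, with `M_{-1} = 0`. -/
def Mpred : ℕ → ℕ
  | 0 => 0
  | n + 1 => P.M n

/-- `ε_n = c₀ α^{- M_{n-1} b / (2p)}`. -/
noncomputable def ε (n : ℕ) : ℝ := P.c₀ * P.α ^ (-((P.Mpred n : ℝ) * P.b / (2 * P.p)))

end Constants

/-- A closed subset of the torus which is the image of a convex subset of `ℝ^d`. -/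
def IsClosedConvexRegion {d : ℕ} (I : Set (Torus d)) : Prop :=
  IsClosed I ∧ ∃ D : Set (EuclideanSpace ℝ (Fin d)), Convex ℝ D ∧ proj d '' D = I

/-- The admissible choices of the constants, and the explicit estimates on the fibre maps. -/
structure SatisfiesEstimates {d : ℕ} (X : Set ℝ) (f : Torus d → ℝ → ℝ) (P : Constants d) :
    Prop where
  e_pos : 0 < P.e
  e_lt_c : P.e < P.c
  c_lt_one : P.c < 1
  region : IsClosedConvexRegion P.I₀
  one_lt_α : 1 < P.α
  sqrt_two_le_p : Real.sqrt 2 ≤ P.p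
  S_pos : 0 < P.S
  maps_to_C : ∀ θ, θ ∉ P.I₀ → ∀ x ∈ Icc P.e 1, f θ x ∈ P.C
  lip_x : ∀ θ, ∀ x ∈ X, ∀ x' ∈ X,
    P.α ^ (-P.p) * |x - x'| ≤ |f θ x - f θ x'| ∧ |f θ x - f θ x'| ≤ P.α ^ P.p * |x - x'|
  lip_θ : ∀ θ θ', ∀ x ∈ X, |f θ x - f θ' x| ≤ P.S * dist θ θ'
  lip_C : ∀ θ, ∀ x ∈ P.C, ∀ x' ∈ P.C, |f θ x - f θ x'| ≤ P.α ^ (-(2 / P.p)) * |x - x'|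
  lip_E : ∀ θ, ∀ x ∈ P.E, ∀ x' ∈ P.E, P.α ^ (2 / P.p) * |x - x'| ≤ |f θ x - f θ x'|
  one_le_K₀ : 1 ≤ P.K₀
  two_le_κ : 2 ≤ P.κ
  b_lim : Tendsto P.bSeq atTop (𝓝 P.b)
  b_large : Real.sqrt ((P.p ^ 2 + 1) / (P.p ^ 2 + 2)) < P.b
  two_le_M₀ : 2 ≤ P.M 0
  M_lower : ∀ n, P.K n * P.M n ≤ P.M (n + 1)
  M_upper : ∀ n, (P.M (n + 1) : ℤ) ≤ 2 * P.K n * P.M n - 2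
  c₀_pos : 0 < P.c₀

/-- The translate `A + kω`. -/
def shift {d : ℕ} (ω : Torus d) (k : ℤ) (A : Set (Torus d)) : Set (Torus d) :=
  (fun θ => θ + k • ω) '' A

/-- The distance `inf {d(x, y) | x ∈ A, y ∈ B}` of two sets. -/
noncomputable def setDist {d : ℕ} (A B : Set (Torus d)) : ENNReal :=
  ⨅ x ∈ A, ⨅ y ∈ B, edist x y

section Critical

variable {d : ℕ} (ω : Torus d) (f : Torus d → ℝ → ℝ) (P : Constants d)

/-- The critical regions: `I_{n+1}` is the projection to `𝕋^d` of
`f^{M_n - 1}(A_n) ∩ f^{-(M_n + 1)}(B_n)`, where `A_n = (I_n - (M_n - 1)ω) × C` and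
`B_n = (I_n + (M_n + 1)ω) × E`. -/
def critRegion : ℕ → Set (Torus d)
  | 0 => P.I₀
  | n + 1 => Prod.fst ''
      (((skew ω f)^[P.M n - 1] '' (shift ω (-((P.M n : ℤ) - 1)) (critRegion n) ×ˢ P.C)) ∩
        ((skew ω f)^[P.M n + 1] ⁻¹' (shift ω ((P.M n : ℤ) + 1) (critRegion n) ×ˢ P.E)))

/-- `⋃_{j < n} ⋃_{l = 1}^{M_j + 1} (I_j + lω)`. -/
def regionV (n : ℕ) : Set (Torus d) :=
  ⋃ j ∈ Iio n, ⋃ l ∈ Icc (1 : ℤ) ((P.M j : ℤ) + 1), shift ω l (critRegion ω f P j)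

/-- `⋃_{j < n} ⋃_{l = -(M_j - 1)}^{0} (I_j + lω)`. -/
def regionW (n : ℕ) : Set (Torus d) :=
  ⋃ j ∈ Iio n, ⋃ l ∈ Icc (-((P.M j : ℤ) - 1)) 0, shift ω l (critRegion ω f P j)

/-- The slow recurrence conditions up to level `n`: for `j = 0, …, n`, the region `I_j` is
non-empty, `d(I_j, ⋃_{k=1}^{2 K_j M_j} (I_j + kω)) > ε_j`, and
`((I_j - (M_j - 1)ω) ∪ (I_j + (M_j + 1)ω)) ∩ (V_{j-1} ∪ W_{j-1}) = ∅`. -/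
def CondF (n : ℕ) : Prop :=
  ∀ j ≤ n, (critRegion ω f P j).Nonempty ∧
    ENNReal.ofReal (P.ε j) <
      setDist (critRegion ω f P j)
        (⋃ k ∈ Icc 1 (2 * P.K j * P.M j), shift ω (k : ℤ) (critRegion ω f P j)) ∧
    (shift ω (-((P.M j : ℤ) - 1)) (critRegion ω f P j) ∪
        shift ω ((P.M j : ℤ) + 1) (critRegion ω f P j)) ∩
      (regionV ω f P j ∪ regionW ω f P j) = ∅

/-- The diameter of `I_n` is smaller than `ε_n`. -/
def CondE (n : ℕ) : Prop :=
  Metric.diam (critRegion ω f P n) < P.ε n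

end Critical

/-- The class `𝒱`: qpf maps with the monotonicity and concavity properties which satisfy, for one
choice of the constants, the explicit estimates and the two dynamical conditions at all levels
`n ≥ 1`. -/
def ClassV {d : ℕ} (ω : Torus d) (X : Set ℝ) (f : Torus d → ℝ → ℝ) : Prop :=
  IsQpfMap ω X f ∧ IsMonotoneConcave X f ∧
    ∃ P : Constants d, SatisfiesEstimates X f P ∧ ∀ n ≥ 1, CondF ω f P n ∧ CondE ω f P n

/-- `Γ = 𝕋^d × [0,1]`. -/
def Γ (d : ℕ) : Set (Torus d × ℝ) := univ ×ˢ Icc 0 1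

/-- The maximal invariant set `Λ = ⋂_{n ∈ ℤ} f^n(Γ)`; for negative exponents, `f^{-n}(Γ)` is the
preimage of `Γ` under `f^n`. -/
def Λ {d : ℕ} (ω : Torus d) (f : Torus d → ℝ → ℝ) : Set (Torus d × ℝ) :=
  (⋂ n : ℕ, (skew ω f)^[n] '' Γ d) ∩ ⋂ n : ℕ, (skew ω f)^[n] ⁻¹' Γ d

/-- The fibre `Λ_θ`. -/
def fibre {d : ℕ} (ω : Torus d) (f : Torus d → ℝ → ℝ) (θ : Torus d) : Set ℝ :=
  {x | x ∈ Icc (0 : ℝ) 1 ∧ (θ, x) ∈ Λ ω f}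

/-- The upper bounding graph `φ⁺(θ) = sup Λ_θ`. -/
noncomputable def phiPlus {d : ℕ} (ω : Torus d) (f : Torus d → ℝ → ℝ) (θ : Torus d) : ℝ :=
  sSup (fibre ω f θ)

/-- Invariant graphs: measurable functions `φ : 𝕋^d → X` with `f_θ(φ(θ)) = φ(θ + ω)` for all
`θ`. -/
structure IsInvariantGraph {d : ℕ} (ω : Torus d) (X : Set ℝ) (f : Torus d → ℝ → ℝ)
    (φ : Torus d → ℝ) : Prop where
  measurable : Measurable φ
  mem : ∀ θ, φ θ ∈ X
  invariant : ∀ θ, f θ (φ θ) = φ (θ + ω)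

end QPF

namespace QPF

/-! ### The torus -/

/-! Write $u_n(\theta)=f^n_{\theta-n\omega}(1)$ for the pullbacks of the line $x=1$ (`upper`). They
are continuous and decrease in $n$. Their infimum is $\phi^+$ as soon as they stay non-negative,
which at once gives non-empty fibres, invariance and upper semi-continuity. Non-negativity
(`upper_nonneg`) holds because non-empty critical regions provide orbit segments of length $2M_j$
that start in $C$ and end in $E$. If some $u_n$ were negative, it would be so on an open set, which
every orbit meets within a bounded time, and a negative orbit never returns.

The rest follows from one approximation statement, `exists_phiPlus_lt`: if $\theta$ is in the
closure of a ball and $G$ has full measure, then points $\theta'\in G$ of the ball arbitrarily close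
to $\theta$ satisfy $\phi^+(\theta')>\phi^+(\theta)-\varepsilon$. Together with semi-continuity of
$\phi^+$ this gives the inclusion for balls. With $G=\{\phi=\phi^+\}$ and semi-continuity of $\phi$
it gives $\phi\ge\phi^+$. The reverse inequality holds because an invariant graph with values in
$[0,1]$ lies in $\Lambda$; only $\phi\le1$ needs a separate argument.

The approximation compares the backward orbits of the graph over $\theta$ and $\theta'$. A positive
gap contracts whenever the point over $\theta'$ is in $C$, since the higher point is then in $C$
too, so it suffices that $\theta'$ has few bad times. By `exists_visit_of_upper_lt`, a bad time
requires a visit to some $\mathcal I_k$ within the previous $M_k+1$ steps. With a horizon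
proportional to $M_j$, visits of level below $j$ are rare by slow recurrence and the bound on $\sum
1/K_k$. Levels above $j$ are avoided by choice of $\theta'$: at distance
$\alpha^{-\mathrm{const}\cdot M_j}$ the ball is larger in measure than all relevant translates of
$\mathcal I_i$, $i>j$.

Level $j$ itself cannot be avoided this way, since $\varepsilon_j$ is too large. But it does harm
only if visited after a time proportional to $M_j$. If this happened at two consecutive high levels,
the nested regions would produce a return of the rotation that is exponentially close in $M_j$ after
a time polynomial in $M_j$, against the Diophantine condition (`eventually_not_both_visit`). So one
of any two consecutive high levels works. -/

instance (d : ℕ) : CompactSpace (Torus d) :=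
  (PiLp.homeomorph 2 (fun _ : Fin d => UnitAddCircle)).symm.compactSpace

/-! ### Equidistribution and minimality of totally irrational rotations. -/

theorem volume_unitAddCircle_univ : volume (univ : Set UnitAddCircle) = 1 := by
  rw [AddCircle.measure_univ, ENNReal.ofReal_one]

theorem mFourier_add_apply {d : ℕ} (k : Fin d → ℤ) (x y : UnitAddTorus (Fin d)) :
    UnitAddTorus.mFourier k (x + y) = UnitAddTorus.mFourier k x * UnitAddTorus.mFourier k y := by
  simp [UnitAddTorus.mFourier, fourier_apply, AddCircle.toCircle_add, smul_add,
    Finset.prod_mul_distrib]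

theorem mFourier_ne_one {d : ℕ} {ω : Torus d} (hω : TotallyIrrational ω) {k : Fin d → ℤ}
    (hk : k ≠ 0) : UnitAddTorus.mFourier k (WithLp.ofLp ω) ≠ 1 := by
  intro h
  have h1 : ∀ s : Finset (Fin d), ((∑ i ∈ s, k i • ω i : UnitAddCircle).toCircle : ℂ) =
      ∏ i ∈ s, fourier (k i) (ω i) := by
    intro s
    induction s using Finset.cons_induction with
    | empty => simp
    | cons a s ha ih =>
      rw [Finset.sum_cons, Finset.prod_cons, ← ih, AddCircle.toCircle_add, fourier_apply]
      simp
  have h2 : (∑ i, k i • ω i : UnitAddCircle).toCircle = (0 : UnitAddCircle).toCircle := by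
    rw [AddCircle.toCircle_zero]
    ext
    rw [h1 Finset.univ]
    simpa [UnitAddTorus.mFourier] using h
  exact hω k hk (AddCircle.injective_toCircle one_ne_zero h2)

/-- Birkhoff averages of continuous functions along a totally irrational rotation converge. -/
theorem tendsto_average {d : ℕ} {ω : Torus d} (hω : TotallyIrrational ω)
    (x : UnitAddTorus (Fin d)) (g : C(UnitAddTorus (Fin d), ℂ)) :
    Tendsto (fun N : ℕ => (N : ℂ)⁻¹ * ∑ k ∈ Finset.range N, g (x + k • WithLp.ofLp ω)) atTop
      (𝓝 (∫ y, g y)) := by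
  have : IsProbabilityMeasure (volume : Measure UnitAddCircle) := ⟨volume_unitAddCircle_univ⟩
  set w : UnitAddTorus (Fin d) := WithLp.ofLp ω with hw
  have hint : ∀ g : C(UnitAddTorus (Fin d), ℂ), Integrable (fun y => g y) volume := fun g =>
    g.continuous.integrable_of_hasCompactSupport (HasCompactSupport.of_compactSpace _)
  -- averages are bounded by the sup norm
  have hbd : ∀ (g : C(UnitAddTorus (Fin d), ℂ)) (N : ℕ),
      ‖(N : ℂ)⁻¹ * ∑ k ∈ Finset.range N, g (x + k • w)‖ ≤ ‖g‖ := by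
    intro g N
    rcases Nat.eq_zero_or_pos N with rfl | hN
    · simp
    have hN' : (0 : ℝ) < N := by exact_mod_cast hN
    rw [norm_mul, norm_inv, Complex.norm_natCast, inv_mul_le_iff₀ hN']
    refine (norm_sum_le _ _).trans ?_
    calc ∑ k ∈ Finset.range N, ‖g (x + k • w)‖ ≤ ∑ k ∈ Finset.range N, ‖g‖ :=
          Finset.sum_le_sum fun k _ => g.norm_coe_le_norm _
      _ = N * ‖g‖ := by simp
  -- Weyl's argument: along the orbit a non-trivial character gives a geometric sum with ratio
  -- different from 1, hence a bounded one, and its integral vanishes by translation invariance. The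
  -- uniform bound `hbd` then passes the limit to the closure of the trigonometric polynomials.
  have hspan : ∀ g ∈ Submodule.span ℂ (range (UnitAddTorus.mFourier (d := Fin d))),
      Tendsto (fun N : ℕ => (N : ℂ)⁻¹ * ∑ k ∈ Finset.range N, g (x + k • w)) atTop
        (𝓝 (∫ y, g y)) := by
    intro g hg
    induction hg using Submodule.span_induction with
    | mem g hg =>
      obtain ⟨k, rfl⟩ := hg
      by_cases hk : k = 0
      · subst hk
        simp only [UnitAddTorus.mFourier_zero, ContinuousMap.one_apply, Finset.sum_const,
          Finset.card_range, nsmul_eq_mul, mul_one, integral_const, probReal_univ, one_smul]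
        refine tendsto_const_nhds.congr' ?_
        filter_upwards [eventually_gt_atTop 0] with N hN
        rw [inv_mul_cancel₀ (by exact_mod_cast hN.ne')]
      · have hz := mFourier_ne_one hω hk
        rw [← hw] at hz
        set z := UnitAddTorus.mFourier k w with hzdef
        have hI : ∫ y, UnitAddTorus.mFourier k y = 0 := by
          have h1 : ∫ y, UnitAddTorus.mFourier k (y + w) = ∫ y, UnitAddTorus.mFourier k y :=
            integral_add_right_eq_self (fun y => UnitAddTorus.mFourier k y) w
          simp only [mFourier_add_apply] at h1
          rw [integral_mul_const, ← hzdef] at h1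
          have h2 : (∫ y, UnitAddTorus.mFourier k y) * (z - 1) = 0 := by
            rw [mul_sub, h1]; ring
          rcases mul_eq_zero.1 h2 with h | h
          · exact h
          · exact absurd (sub_eq_zero.1 h) hz
        rw [hI]
        have hpow : ∀ n : ℕ, UnitAddTorus.mFourier k (x + n • w) =
            UnitAddTorus.mFourier k x * z ^ n := by
          intro n
          induction n with
          | zero => simp
          | succ n ih =>
            rw [succ_nsmul, ← add_assoc, mFourier_add_apply, ih, pow_succ, ← hzdef]; ring
        have hz1 : ‖z‖ ≤ 1 := by
          simpa [UnitAddTorus.mFourier_norm] using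
            (UnitAddTorus.mFourier k).norm_coe_le_norm w
        simp only [hpow, ← Finset.mul_sum]
        have hx1 : ‖UnitAddTorus.mFourier k x‖ ≤ 1 := by
          simpa [UnitAddTorus.mFourier_norm] using
            (UnitAddTorus.mFourier k).norm_coe_le_norm x
        have hz0 : 0 < ‖z - 1‖ := norm_pos_iff.2 (sub_ne_zero.2 hz)
        refine squeeze_zero_norm (a := fun N : ℕ => (N : ℝ)⁻¹ * (2 / ‖z - 1‖)) (fun N => ?_) ?_
        · rw [norm_mul, norm_mul, norm_inv, Complex.norm_natCast]
          refine mul_le_mul_of_nonneg_left ?_ (by positivity)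
          refine (mul_le_of_le_one_left (norm_nonneg _) hx1).trans ?_
          rw [geom_sum_eq hz, norm_div]
          refine div_le_div_of_nonneg_right ?_ hz0.le
          refine (norm_sub_le _ _).trans ?_
          rw [norm_pow, norm_one]
          linarith [pow_le_one₀ (n := N) (norm_nonneg z) hz1]
        · simpa using tendsto_inv_atTop_nhds_zero_nat.mul_const (2 / ‖z - 1‖)
    | zero => simp
    | add g h _ _ hg hh =>
      have := hg.add hh
      rw [← integral_add (hint g) (hint h)] at this
      refine this.congr fun N => ?_
      simp [Finset.sum_add_distrib, mul_add]
    | smul c g _ hg =>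
      have := hg.const_mul c
      rw [← integral_const_mul] at this
      refine this.congr fun N => ?_
      simp only [ContinuousMap.smul_apply, smul_eq_mul, ← Finset.mul_sum]
      ring
  rw [Metric.tendsto_atTop]
  intro ε hε
  have hg : g ∈ closure
      (Submodule.span ℂ (range (UnitAddTorus.mFourier (d := Fin d))) : Set _) := by
    rw [← Submodule.topologicalClosure_coe, UnitAddTorus.span_mFourier_closure_eq_top]
    trivial
  obtain ⟨h, hh, hgh⟩ := Metric.mem_closure_iff.1 hg (ε / 3) (by positivity)
  obtain ⟨N₀, hN₀⟩ := Metric.tendsto_atTop.1 (hspan h hh) (ε / 3) (by positivity)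
  refine ⟨N₀, fun N hN => ?_⟩
  have e1 := hbd (g - h) N
  simp only [ContinuousMap.sub_apply, Finset.sum_sub_distrib, mul_sub] at e1
  have e2 : ‖(∫ y, h y) - ∫ y, g y‖ ≤ ‖g - h‖ := by
    rw [← integral_sub (hint h) (hint g)]
    have := norm_integral_le_of_norm_le_const (μ := (volume : Measure (UnitAddTorus (Fin d))))
      (f := fun y => h y - g y) (C := ‖g - h‖) (Eventually.of_forall fun y => by
        rw [norm_sub_rev]; exact (g - h).norm_coe_le_norm y)
    simpa using this
  have e3 := hN₀ N hN
  rw [dist_eq_norm] at e3 hgh ⊢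
  calc _ ≤ _ := norm_sub_le_norm_sub_add_norm_sub _ (((N : ℂ)⁻¹ * ∑ k ∈ Finset.range N, h (x + k • w))) _
    _ ≤ ‖g - h‖ + (‖(N : ℂ)⁻¹ * ∑ k ∈ Finset.range N, h (x + k • w) - ∫ y, h y‖ +
          ‖(∫ y, h y) - ∫ y, g y‖) :=
        add_le_add e1 (norm_sub_le_norm_sub_add_norm_sub _ _ _)
    _ < ε := by linarith

/-- Forward orbits of a totally irrational rotation are dense. -/
theorem exists_nsmul_mem {d : ℕ} {ω : Torus d} (hω : TotallyIrrational ω) (x : Torus d)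
    {U : Set (Torus d)} (hU : IsOpen U) (hne : U.Nonempty) : ∃ k : ℕ, x + k • ω ∈ U := by
  by_contra! hno
  have : IsProbabilityMeasure (volume : Measure UnitAddCircle) := ⟨volume_unitAddCircle_univ⟩
  by_cases hUc : Uᶜ = ∅
  · exact hno 0 (by rw [compl_empty_iff.1 hUc]; trivial)
  have hUc' : (Uᶜ).Nonempty := nonempty_iff_ne_empty.2 hUc
  -- This function is positive exactly on `U`. An orbit that misses `U` has zero averages, whereas
  -- the integral is positive.
  let G : C(UnitAddTorus (Fin d), ℝ) :=
    ⟨fun y => Metric.infDist (WithLp.toLp 2 y : Torus d) Uᶜ,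
      (Metric.continuous_infDist_pt _).comp (PiLp.continuous_toLp 2 _)⟩
  let g : C(UnitAddTorus (Fin d), ℂ) := ⟨fun y => (G y : ℂ), by fun_prop⟩
  have h1 := tendsto_average hω (WithLp.ofLp x) g
  have h2 : ∀ k : ℕ, g (WithLp.ofLp x + k • WithLp.ofLp ω) = 0 := by
    intro k
    have : G (WithLp.ofLp x + k • WithLp.ofLp ω) = 0 := by
      change Metric.infDist (x + k • ω) Uᶜ = 0
      exact Metric.infDist_zero_of_mem (hno k)
    change ((G _ : ℝ) : ℂ) = 0
    rw [this]; simp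
  simp only [h2, Finset.sum_const_zero, mul_zero] at h1
  have h3 : (∫ y, G y) = 0 := by
    have := tendsto_nhds_unique h1 tendsto_const_nhds
    have h4 : ∫ y, g y = ((∫ y, G y : ℝ) : ℂ) := integral_ofReal
    rw [h4] at this
    exact_mod_cast this
  obtain ⟨u, hu⟩ := hne
  have hpos : 0 < ∫ y, G y := by
    refine G.continuous.integral_pos_of_hasCompactSupport_nonneg_nonzero
      (HasCompactSupport.of_compactSpace _) (fun y => Metric.infDist_nonneg)
      (x := WithLp.ofLp u) ?_
    change Metric.infDist u Uᶜ ≠ 0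
    exact ((hU.isClosed_compl.notMem_iff_infDist_pos hUc').1 (by simpa using hu)).ne'
  exact hpos.ne' h3

theorem TotallyIrrational.neg {d : ℕ} {ω : Torus d} (hω : TotallyIrrational ω) :
    TotallyIrrational (-ω) := by
  intro k hk h
  apply hω k hk
  simpa using h

/-- Every orbit hits a given non-empty open set within a uniformly bounded time. -/
theorem exists_uniform_nsmul_mem {d : ℕ} {ω : Torus d} (hω : TotallyIrrational ω)
    {U : Set (Torus d)} (hU : IsOpen U) (hne : U.Nonempty) :
    ∃ L : ℕ, ∀ x : Torus d, ∃ k ≤ L, x + k • ω ∈ U := by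
  obtain ⟨t, ht⟩ := isCompact_univ.elim_finite_subcover
    (fun k : ℕ => (fun x : Torus d => x + k • ω) ⁻¹' U)
    (fun k => hU.preimage (by fun_prop)) (fun x _ => by
      obtain ⟨k, hk⟩ := exists_nsmul_mem hω x hU hne
      exact mem_iUnion.2 ⟨k, hk⟩)
  refine ⟨t.sup id, fun x => ?_⟩
  obtain ⟨k, hk, hx⟩ := mem_iUnion₂.1 (ht (mem_univ x))
  exact ⟨k, Finset.le_sup (f := id) hk, hx⟩

/-! ### Measure of balls and lifts to Euclidean space. -/

theorem leb_apply {d : ℕ} {s : Set (Torus d)} (hs : MeasurableSet s) :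
    leb d s = volume ((WithLp.toLp 2 : (Fin d → UnitAddCircle) → Torus d) ⁻¹' s) :=
  Measure.map_apply (WithLp.measurable_toLp 2 _) hs

/-- One coordinate alone gives this bound. The loss of powers of `ε` is harmless, because it is
applied to exponentially small radii. -/
theorem leb_closedBall_le {d : ℕ} (hd : 0 < d) (p : Torus d) (ε : ℝ) :
    leb d (Metric.closedBall p ε) ≤ ENNReal.ofReal (2 * ε) := by
  have : IsProbabilityMeasure (volume : Measure UnitAddCircle) := ⟨volume_unitAddCircle_univ⟩
  rw [leb_apply Metric.isClosed_closedBall.measurableSet]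
  have hsub : (WithLp.toLp 2 : (Fin d → UnitAddCircle) → Torus d) ⁻¹' Metric.closedBall p ε ⊆
      (fun y => y ⟨0, hd⟩) ⁻¹' Metric.closedBall (p ⟨0, hd⟩) ε := by
    intro y hy
    rw [mem_preimage, Metric.mem_closedBall] at hy ⊢
    refine le_trans ?_ hy
    rw [dist_eq_norm, dist_eq_norm]
    exact PiLp.norm_apply_le (WithLp.toLp 2 y - p : Torus d) ⟨0, hd⟩
  refine (measure_mono hsub).trans ?_
  refine ((measurePreserving_eval (fun _ : Fin d => (volume : Measure UnitAddCircle))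
    ⟨0, hd⟩).measure_preimage
      Metric.isClosed_closedBall.measurableSet.nullMeasurableSet).le.trans ?_
  rw [AddCircle.volume_closedBall]
  exact ENNReal.ofReal_le_ofReal (min_le_right _ _)

theorem le_leb_ball {d : ℕ} (hd : 0 < d) (q : Torus d) {s : ℝ} (hs : 0 < s) (hs1 : s ≤ 1) :
    ENNReal.ofReal ((s / d) ^ d) ≤ leb d (Metric.ball q s) := by
  have : IsProbabilityMeasure (volume : Measure UnitAddCircle) := ⟨volume_unitAddCircle_univ⟩
  have hd1 : (1 : ℝ) ≤ d := by exact_mod_cast hd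
  rw [leb_apply Metric.isOpen_ball.measurableSet]
  have hsub : (univ.pi fun i => Metric.closedBall (q i) (s / (2 * d))) ⊆
      (WithLp.toLp 2 : (Fin d → UnitAddCircle) → Torus d) ⁻¹' Metric.ball q s := by
    intro y hy
    rw [mem_preimage, Metric.mem_ball, PiLp.dist_eq_of_L2]
    rw [Real.sqrt_lt' hs]
    calc ∑ i, dist (y i) (q i) ^ 2 ≤ ∑ _i : Fin d, (s / (2 * d)) ^ 2 :=
          Finset.sum_le_sum fun i _ => pow_le_pow_left₀ dist_nonneg (hy i trivial) 2
      _ = s ^ 2 / (4 * d) := by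
          simp only [Finset.sum_const, Finset.card_univ, Fintype.card_fin, nsmul_eq_mul]
          field_simp
          ring
      _ < s ^ 2 := by
          rw [div_lt_iff₀ (by positivity)]
          nlinarith [pow_pos hs 2]
  refine le_trans ?_ (measure_mono hsub)
  rw [volume_pi_pi]
  have h1 : (2 * (s / (2 * d)) : ℝ) = s / d := by field_simp
  have h2 : s / (d : ℝ) ≤ 1 := (div_le_one (by positivity)).2 (hs1.trans hd1)
  simp only [AddCircle.volume_closedBall, h1, min_eq_right h2, Finset.prod_const, Finset.card_univ,
    Fintype.card_fin]
  rw [ENNReal.ofReal_pow (by positivity)]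

theorem exists_proj_eq {d : ℕ} (x : Torus d) :
    ∃ v : EuclideanSpace ℝ (Fin d), proj d v = x ∧ ‖v‖ = ‖x‖ := by
  have h : ∀ i, ∃ t : ℝ, (t : UnitAddCircle) = x i ∧ |t| = ‖x i‖ := by
    intro i
    obtain ⟨y, hy⟩ := QuotientAddGroup.mk_surjective (x i)
    refine ⟨y - round y, ?_, ?_⟩
    · rw [← hy, AddCircle.coe_sub]
      have : ((round y : ℝ) : UnitAddCircle) = 0 := by
        rw [AddCircle.coe_eq_zero_iff]
        exact ⟨round y, by simp⟩
      rw [this, sub_zero]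
    · rw [← hy]
      exact (UnitAddCircle.norm_eq (x := y)).symm
  choose t ht ht' using h
  refine ⟨WithLp.toLp 2 t, ?_, ?_⟩
  · ext i
    simpa [proj] using ht i
  · rw [EuclideanSpace.norm_eq, PiLp.norm_eq_of_L2]
    simp [ht']

theorem norm_proj_le {d : ℕ} (v : EuclideanSpace ℝ (Fin d)) : ‖proj d v‖ ≤ ‖v‖ := by
  rw [EuclideanSpace.norm_eq, PiLp.norm_eq_of_L2]
  refine Real.sqrt_le_sqrt (Finset.sum_le_sum fun i _ => ?_)
  refine pow_le_pow_left₀ (norm_nonneg _) ?_ 2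
  change ‖((v i : ℝ) : UnitAddCircle)‖ ≤ ‖v i‖
  rw [UnitAddCircle.norm_eq, Real.norm_eq_abs]
  simpa using round_le (v i) 0

/-- The centre `q` lies on a shortest lifted segment from `θ` to `θ₀`, at the fraction `τ = δ /
(2r)` of the way. It is thus within `δ / 2` of `θ` and within `r - δ / 2` of `θ₀`. -/
theorem exists_ball_subset {d : ℕ} {θ θ₀ : Torus d} {r δ : ℝ} (hδ : 0 < δ) (hδr : δ ≤ 2 * r)
    (hθ : θ ∈ closure (Metric.ball θ₀ r)) :
    ∃ q, Metric.ball q (δ / 2) ⊆ Metric.ball θ₀ r ∩ Metric.ball θ δ := by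
  have hr : 0 < r := by linarith
  have hθ' : ‖θ - θ₀‖ ≤ r := by
    rw [← dist_eq_norm]
    exact Metric.closure_ball_subset_closedBall hθ
  obtain ⟨v, hv, hvn⟩ := exists_proj_eq (θ - θ₀)
  have hsub : ∀ a b : EuclideanSpace ℝ (Fin d), proj d (a + b) = proj d a + proj d b := by
    intro a b
    ext i
    simp [proj]
  set τ := δ / (2 * r) with hτ
  have hτ0 : 0 < τ := by positivity
  have hτ1 : τ ≤ 1 := (div_le_one (by positivity)).2 hδr
  have hτr : τ * r = δ / 2 := by rw [hτ]; field_simp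
  have hq2 : θ - (θ₀ + proj d ((1 - τ) • v)) = proj d (τ • v) := by
    have : proj d v = proj d ((1 - τ) • v) + proj d (τ • v) := by
      rw [← hsub, ← add_smul, sub_add_cancel, one_smul]
    rw [← sub_sub, ← hv, this]; abel
  have e1 : ‖proj d ((1 - τ) • v)‖ ≤ r - δ / 2 := by
    refine (norm_proj_le _).trans ?_
    rw [norm_smul, Real.norm_of_nonneg (by linarith), hvn]
    nlinarith
  have e2 : ‖proj d (τ • v)‖ ≤ δ / 2 := by
    refine (norm_proj_le _).trans ?_
    rw [norm_smul, Real.norm_of_nonneg hτ0.le, hvn]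
    nlinarith
  refine ⟨θ₀ + proj d ((1 - τ) • v), fun x hx => ⟨?_, ?_⟩⟩
  · rw [Metric.mem_ball] at hx ⊢
    have := dist_triangle x (θ₀ + proj d ((1 - τ) • v)) θ₀
    have h3 : dist (θ₀ + proj d ((1 - τ) • v)) θ₀ = ‖proj d ((1 - τ) • v)‖ := by
      rw [dist_eq_norm, add_sub_cancel_left]
    linarith
  · rw [Metric.mem_ball] at hx ⊢
    have := dist_triangle x (θ₀ + proj d ((1 - τ) • v)) θ
    have h3 : dist (θ₀ + proj d ((1 - τ) • v)) θ = ‖proj d (τ • v)‖ := by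
      rw [dist_comm, dist_eq_norm, hq2]
    linarith

/-! ### Iterated fibre maps and the pullback of the upper boundary line -/

/-- The second component of the `n`-th iterate of the skew product. -/
def iter {d : ℕ} (ω : Torus d) (f : Torus d → ℝ → ℝ) (n : ℕ) (θ : Torus d) (x : ℝ) : ℝ :=
  ((skew ω f)^[n] (θ, x)).2

/-- The `n`-th iterate of the line `x = 1`, over the point `θ`. -/
def upper {d : ℕ} (ω : Torus d) (f : Torus d → ℝ → ℝ) (n : ℕ) (θ : Torus d) : ℝ :=
  iter ω f n (θ - n • ω) 1

section Iterates

variable {d : ℕ} {ω : Torus d} {X : Set ℝ} {f : Torus d → ℝ → ℝ} {P : Constants d}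

theorem skew_iterate (n : ℕ) (θ : Torus d) (x : ℝ) :
    (skew ω f)^[n] (θ, x) = (θ + n • ω, iter ω f n θ x) := by
  refine Prod.ext ?_ rfl
  induction n with
  | zero => simp
  | succ n ih =>
    rw [Function.iterate_succ_apply', skew, ih, succ_nsmul, add_assoc]

@[simp] theorem iter_zero (θ : Torus d) (x : ℝ) : iter ω f 0 θ x = x := rfl

theorem iter_succ (n : ℕ) (θ : Torus d) (x : ℝ) :
    iter ω f (n + 1) θ x = f (θ + n • ω) (iter ω f n θ x) := by
  rw [iter, Function.iterate_succ_apply', skew_iterate]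
  rfl

theorem iter_add (m n : ℕ) (θ : Torus d) (x : ℝ) :
    iter ω f (m + n) θ x = iter ω f n (θ + m • ω) (iter ω f m θ x) := by
  rw [iter, add_comm, Function.iterate_add_apply, skew_iterate m θ x]
  rfl

@[simp] theorem upper_zero (θ : Torus d) : upper ω f 0 θ = 1 := rfl

theorem upper_succ (n : ℕ) (θ : Torus d) :
    upper ω f (n + 1) θ = f (θ - ω) (upper ω f n (θ - ω)) := by
  rw [upper, iter_succ, upper]
  have h1 : θ - (n + 1) • ω + n • ω = θ - ω := by rw [succ_nsmul]; abel
  have h2 : θ - (n + 1) • ω = θ - ω - n • ω := by rw [succ_nsmul]; abel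
  rw [h1, h2]

theorem iter_upper (k n : ℕ) (θ : Torus d) :
    iter ω f n θ (upper ω f k θ) = upper ω f (k + n) (θ + n • ω) := by
  induction n with
  | zero => simp
  | succ n ih =>
    rw [iter_succ, ih, ← add_assoc, upper_succ]
    congr 2 <;> · rw [succ_nsmul]; abel_nf

theorem one_mem (hq : IsQpfMap ω X f) : (1 : ℝ) ∈ X := hq.unit_subset (by norm_num)

theorem zero_mem (hq : IsQpfMap ω X f) : (0 : ℝ) ∈ X := hq.unit_subset (by norm_num)

theorem iter_mem (hq : IsQpfMap ω X f) (n : ℕ) (θ : Torus d) {x : ℝ} (hx : x ∈ X) :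
    iter ω f n θ x ∈ X := by
  induction n with
  | zero => exact hx
  | succ n ih => rw [iter_succ]; exact hq.mapsTo _ ih

theorem iter_mono (hq : IsQpfMap ω X f) (n : ℕ) (θ : Torus d) {x y : ℝ} (hx : x ∈ X) (hy : y ∈ X)
    (hxy : x ≤ y) : iter ω f n θ x ≤ iter ω f n θ y := by
  induction n with
  | zero => exact hxy
  | succ n ih =>
    rw [iter_succ, iter_succ]
    exact hq.monotone _ (iter_mem hq n θ hx) (iter_mem hq n θ hy) ih

theorem map_le_one (hq : IsQpfMap ω X f) (hc : IsMonotoneConcave X f) (θ : Torus d) {x : ℝ}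
    (hx : x ∈ X) (hx1 : x ≤ 1) : f θ x ≤ 1 :=
  (hq.monotone θ hx (one_mem hq) hx1).trans (hc.one_le θ)

theorem iter_le_one (hq : IsQpfMap ω X f) (hc : IsMonotoneConcave X f) (n : ℕ) (θ : Torus d)
    {x : ℝ} (hx : x ∈ X) (hx1 : x ≤ 1) : iter ω f n θ x ≤ 1 := by
  induction n with
  | zero => exact hx1
  | succ n ih => rw [iter_succ]; exact map_le_one hq hc _ (iter_mem hq n θ hx) ih

theorem SatisfiesEstimates.α_pos (hP : SatisfiesEstimates X f P) : 0 < P.α :=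
  zero_lt_one.trans hP.one_lt_α

/-- The lower Lipschitz bound makes the monotone map `f θ` strict between `x` and `0`. -/
theorem map_neg (hq : IsQpfMap ω X f) (hc : IsMonotoneConcave X f) (hP : SatisfiesEstimates X f P)
    (θ : Torus d) {x : ℝ} (hx : x ∈ X) (hx0 : x < 0) : f θ x < 0 := by
  have h1 : f θ x ≤ f θ 0 := hq.monotone θ hx (zero_mem hq) hx0.le
  have h2 := (hP.lip_x θ x hx 0 (zero_mem hq)).1
  have h3 : 0 < P.α ^ (-P.p) * |x - 0| :=
    mul_pos (Real.rpow_pos_of_pos hP.α_pos _) (abs_pos.2 (by linarith))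
  rcases (h1.trans (hc.zero_le θ)).lt_or_eq with h | h
  · exact h
  · have h4 : f θ 0 = 0 := le_antisymm (hc.zero_le θ) (h ▸ h1)
    rw [h, h4] at h2
    simp only [sub_zero, abs_zero] at h2 h3
    linarith

theorem iter_neg (hq : IsQpfMap ω X f) (hc : IsMonotoneConcave X f)
    (hP : SatisfiesEstimates X f P) (n : ℕ) (θ : Torus d) {x : ℝ} (hx : x ∈ X) (hx0 : x < 0) :
    iter ω f n θ x < 0 := by
  induction n with
  | zero => exact hx0
  | succ n ih => rw [iter_succ]; exact map_neg hq hc hP _ (iter_mem hq n θ hx) ih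

theorem upper_mem (hq : IsQpfMap ω X f) (n : ℕ) (θ : Torus d) : upper ω f n θ ∈ X :=
  iter_mem hq _ _ (one_mem hq)

theorem upper_le_one (hq : IsQpfMap ω X f) (hc : IsMonotoneConcave X f) (n : ℕ) (θ : Torus d) :
    upper ω f n θ ≤ 1 :=
  iter_le_one hq hc _ _ (one_mem hq) le_rfl

theorem upper_antitone (hq : IsQpfMap ω X f) (hc : IsMonotoneConcave X f) (θ : Torus d) :
    Antitone fun n => upper ω f n θ := by
  refine antitone_nat_of_succ_le fun n => ?_
  induction n generalizing θ with
  | zero => exact upper_le_one hq hc _ _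
  | succ n ih =>
    rw [upper_succ (n + 1) θ, upper_succ n θ]
    exact hq.monotone _ (upper_mem hq _ _) (upper_mem hq _ _) (ih _)

theorem continuous_fibre_comp (hP : SatisfiesEstimates X f P) {Y : Type*} [TopologicalSpace Y]
    {g : Y → Torus d} {h : Y → ℝ} (hg : Continuous g) (hh : Continuous h) (hX : ∀ y, h y ∈ X) :
    Continuous fun y => f (g y) (h y) := by
  rw [continuous_iff_continuousAt]
  intro y
  rw [ContinuousAt, tendsto_iff_dist_tendsto_zero]
  have hlim : Tendsto (fun z => P.S * dist (g z) (g y) + P.α ^ P.p * |h z - h y|) (𝓝 y) (𝓝 0) := by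
    have h1 : Tendsto (fun z => dist (g z) (g y)) (𝓝 y) (𝓝 0) :=
      tendsto_iff_dist_tendsto_zero.1 hg.continuousAt
    have h2 : Tendsto (fun z => |h z - h y|) (𝓝 y) (𝓝 0) :=
      tendsto_iff_dist_tendsto_zero.1 hh.continuousAt
    simpa using (h1.const_mul P.S).add (h2.const_mul (P.α ^ P.p))
  refine squeeze_zero (fun _ => dist_nonneg) (fun z => ?_) hlim
  rw [Real.dist_eq]
  calc |f (g z) (h z) - f (g y) (h y)|
      ≤ |f (g z) (h z) - f (g y) (h z)| + |f (g y) (h z) - f (g y) (h y)| := abs_sub_le _ _ _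
    _ ≤ _ := add_le_add (hP.lip_θ _ _ _ (hX z)) (hP.lip_x _ _ (hX z) _ (hX y)).2

theorem continuous_upper (hq : IsQpfMap ω X f) (hP : SatisfiesEstimates X f P) (n : ℕ) :
    Continuous (upper ω f n) := by
  induction n with
  | zero => exact continuous_const
  | succ n ih =>
    simp only [funext (upper_succ (ω := ω) (f := f) n)]
    exact continuous_fibre_comp hP (by fun_prop) (ih.comp (by fun_prop)) fun _ => upper_mem hq _ _

theorem continuousOn_iter (hq : IsQpfMap ω X f) (hP : SatisfiesEstimates X f P) (n : ℕ)
    (θ : Torus d) : ContinuousOn (iter ω f n θ) X := by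
  rw [continuousOn_iff_continuous_domRestrict]
  induction n with
  | zero => exact continuous_subtype_val
  | succ n ih =>
    have : X.domRestrict (iter ω f (n + 1) θ) = fun x => f (θ + n • ω) (X.domRestrict (iter ω f n θ) x) :=
      funext fun x => iter_succ n θ x
    rw [this]
    exact continuous_fibre_comp hP continuous_const ih fun x => iter_mem hq n θ x.2

theorem C_subset (hq : IsQpfMap ω X f) (hP : SatisfiesEstimates X f P) : P.C ⊆ X := fun _ hx =>
  hq.unit_subset ⟨hP.e_pos.le.trans (hP.e_lt_c.le.trans hx.1), hx.2⟩

theorem one_mem_C (hP : SatisfiesEstimates X f P) : (1 : ℝ) ∈ P.C := ⟨hP.c_lt_one.le, le_rfl⟩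

/-! ### The critical regions -/

theorem K_pos (hP : SatisfiesEstimates X f P) (n : ℕ) : 1 ≤ P.K n :=
  Nat.one_le_iff_ne_zero.2 (mul_ne_zero (by have := hP.one_le_K₀; omega)
    (pow_ne_zero _ (by have := hP.two_le_κ; omega)))

theorem two_le_M (hP : SatisfiesEstimates X f P) (n : ℕ) : 2 ≤ P.M n := by
  induction n with
  | zero => exact hP.two_le_M₀
  | succ n ih =>
    exact ih.trans ((Nat.le_mul_of_pos_left _ (K_pos hP n)).trans (hP.M_lower n))

theorem mem_shift {k : ℤ} {A : Set (Torus d)} {θ : Torus d} :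
    θ ∈ shift ω k A ↔ θ - k • ω ∈ A := by
  constructor
  · rintro ⟨x, hx, rfl⟩
    simpa using hx
  · exact fun h => ⟨_, h, sub_add_cancel _ _⟩

/-- The rotation determines the base point, so what remains is an orbit segment of `2 * P.M n` steps
from `C` to `E` that passes over `θ` after `P.M n - 1` steps. -/
theorem mem_critRegion_succ (hP : SatisfiesEstimates X f P) {n : ℕ} {θ : Torus d} :
    θ ∈ critRegion ω f P (n + 1) ↔ θ ∈ critRegion ω f P n ∧ ∃ x ∈ P.C,
      iter ω f (P.M n + 1) θ (iter ω f (P.M n - 1) (θ - (P.M n - 1) • ω) x) ∈ P.E := by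
  have hM := two_le_M hP n
  have hcast : ((P.M n : ℤ) - 1) = ((P.M n - 1 : ℕ) : ℤ) := by omega
  constructor
  · rintro ⟨⟨θ', y⟩, ⟨⟨⟨θ₀, x⟩, ⟨h1, h2⟩, h3⟩, h4⟩, rfl⟩
    rw [skew_iterate] at h3
    obtain ⟨rfl, rfl⟩ := Prod.mk.inj h3
    have h5 : θ₀ + (P.M n - 1) • ω ∈ critRegion ω f P n := by
      rw [mem_shift, hcast, neg_smul, sub_neg_eq_add, natCast_zsmul] at h1
      exact h1
    refine ⟨h5, x, h2, ?_⟩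
    rw [mem_preimage, skew_iterate] at h4
    simpa using h4.2
  · rintro ⟨h1, x, hx, h2⟩
    refine ⟨(θ, iter ω f (P.M n - 1) (θ - (P.M n - 1) • ω) x), ⟨⟨(θ - (P.M n - 1) • ω, x), ⟨?_, hx⟩,
      ?_⟩, ?_⟩, rfl⟩
    · rw [mem_shift, hcast, neg_smul, sub_neg_eq_add, natCast_zsmul]
      simpa using h1
    · rw [skew_iterate]; simp
    · rw [mem_preimage, skew_iterate]
      refine ⟨?_, h2⟩
      rw [mem_shift]
      have : ((P.M n : ℤ) + 1) • ω = (P.M n + 1) • ω := by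
        rw [← natCast_zsmul]; push_cast; rfl
      rwa [this, add_sub_cancel_right]

theorem critRegion_antitone (hP : SatisfiesEstimates X f P) : Antitone (critRegion ω f P) :=
  antitone_nat_of_succ_le fun _ _ h => ((mem_critRegion_succ hP).1 h).1

/-- The pullbacks of the line `x = 1` never leave `[0,1]`, provided that all critical regions are
non-empty. -/
theorem upper_nonneg (hq : IsQpfMap ω X f) (hc : IsMonotoneConcave X f)
    (hP : SatisfiesEstimates X f P) (hne : ∀ j, (critRegion ω f P j).Nonempty)
    (hM : Tendsto P.M atTop atTop) (n : ℕ) (θ : Torus d) : 0 ≤ upper ω f n θ := by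
  by_contra! hneg
  obtain ⟨L, hL⟩ := exists_uniform_nsmul_mem hq.totallyIrrational
    (isOpen_Iio.preimage (continuous_upper hq hP n) : IsOpen (upper ω f n ⁻¹' Iio 0)) ⟨θ, hneg⟩
  -- The segment from `C` to `E` has `2 * P.M j` steps, enough to meet the set where `upper n` is
  -- negative and still have time left.
  obtain ⟨j, hj⟩ := (hM.eventually_ge_atTop (L + n)).exists
  obtain ⟨z, hz⟩ := hne (j + 1)
  obtain ⟨-, y, hy, hyE⟩ := (mem_critRegion_succ hP).1 hz
  have hMj := two_le_M hP j
  set z₀ := z - (P.M j - 1) • ω with hz₀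
  have hz1 : z = z₀ + (P.M j - 1) • ω := by rw [hz₀, sub_add_cancel]
  rw [hz1, ← iter_add] at hyE
  obtain ⟨k, hk, hkU⟩ := hL (z₀ + n • ω)
  have hyX := C_subset hq hP hy
  have h1 : iter ω f (k + n) z₀ y < 0 := by
    rw [iter_add]
    refine lt_of_le_of_lt (iter_mono hq n _ (iter_mem hq k _ hyX) (one_mem hq)
      (iter_le_one hq hc k _ hyX hy.2)) ?_
    have : upper ω f n (z₀ + n • ω + k • ω) < 0 := hkU
    rw [upper] at this
    rwa [show z₀ + n • ω + k • ω - n • ω = z₀ + k • ω by abel] at this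
  have h2 : P.M j - 1 + (P.M j + 1) = (k + n) + (2 * P.M j - (k + n)) := by omega
  rw [h2, iter_add] at hyE
  exact absurd hyE.1 (not_le.2 (iter_neg hq hc hP _ _ (iter_mem hq _ _ hyX) h1))

/-! ### The upper bounding graph -/

theorem tendsto_upper_iInf (hpos : ∀ n θ, 0 ≤ upper ω f n θ)
    (hq : IsQpfMap ω X f) (hc : IsMonotoneConcave X f) (θ : Torus d) :
    Tendsto (fun n => upper ω f n θ) atTop (𝓝 (⨅ n, upper ω f n θ)) :=
  tendsto_atTop_ciInf (upper_antitone hq hc θ) ⟨0, by rintro _ ⟨n, rfl⟩; exact hpos n θ⟩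

theorem iInf_upper_le (hpos : ∀ n θ, 0 ≤ upper ω f n θ) (n : ℕ) (θ : Torus d) :
    ⨅ n, upper ω f n θ ≤ upper ω f n θ :=
  ciInf_le ⟨0, by rintro _ ⟨n, rfl⟩; exact hpos n θ⟩ n

theorem iInf_upper_mem_Icc (hpos : ∀ n θ, 0 ≤ upper ω f n θ) (θ : Torus d) :
    ⨅ n, upper ω f n θ ∈ Icc (0 : ℝ) 1 :=
  ⟨le_ciInf fun n => hpos n θ, iInf_upper_le hpos 0 θ⟩

theorem iInf_upper_invariant (hpos : ∀ n θ, 0 ≤ upper ω f n θ)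
    (hq : IsQpfMap ω X f) (hc : IsMonotoneConcave X f) (hP : SatisfiesEstimates X f P)
    (θ : Torus d) : f θ (⨅ n, upper ω f n θ) = ⨅ n, upper ω f n (θ + ω) := by
  have h1 := (tendsto_add_atTop_iff_nat 1).2 (tendsto_upper_iInf hpos hq hc (θ + ω))
  simp only [upper_succ, add_sub_cancel_right] at h1
  refine tendsto_nhds_unique ?_ h1
  have hcont := continuousOn_iter hq hP 1 θ
  have h2 : iter ω f 1 θ = f θ := by
    funext x; rw [iter_succ]; simp
  rw [h2] at hcont
  exact ((hcont _ (hq.unit_subset (iInf_upper_mem_Icc hpos θ))).tendsto).comp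
    (tendsto_nhdsWithin_iff.2 ⟨tendsto_upper_iInf hpos hq hc θ,
      Eventually.of_forall fun n => upper_mem hq n θ⟩)

/-- A family of points in `[0,1]` which is invariant under the skew product lies in `Λ`. -/
theorem mem_fibre_of_invariant {φ : Torus d → ℝ} (hφ : ∀ θ, φ θ ∈ Icc (0 : ℝ) 1)
    (hinv : ∀ θ, f θ (φ θ) = φ (θ + ω)) (θ : Torus d) : φ θ ∈ fibre ω f θ := by
  have hit : ∀ (n : ℕ) (θ : Torus d), iter ω f n θ (φ θ) = φ (θ + n • ω) := by
    intro n θ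
    induction n with
    | zero => simp
    | succ n ih => rw [iter_succ, ih, hinv, succ_nsmul, add_assoc]
  refine ⟨hφ θ, mem_iInter.2 fun n => ⟨(θ - n • ω, φ (θ - n • ω)), ⟨trivial, hφ _⟩, ?_⟩,
    mem_iInter.2 fun n => ?_⟩
  · rw [skew_iterate, hit, sub_add_cancel]
  · rw [mem_preimage, skew_iterate, hit]
    exact ⟨trivial, hφ _⟩

theorem fibre_le_upper (hq : IsQpfMap ω X f) {θ : Torus d} {x : ℝ} (hx : x ∈ fibre ω f θ) (n : ℕ) :
    x ≤ upper ω f n θ := by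
  obtain ⟨⟨θ', y⟩, ⟨-, hy⟩, h⟩ := mem_iInter.1 hx.2.1 n
  rw [skew_iterate] at h
  obtain ⟨rfl, rfl⟩ := Prod.mk.inj h
  rw [upper, add_sub_cancel_right]
  exact iter_mono hq _ _ (hq.unit_subset hy) (one_mem hq) hy.2

theorem le_phiPlus (θ : Torus d) {x : ℝ} (hx : x ∈ fibre ω f θ) : x ≤ phiPlus ω f θ :=
  le_csSup ⟨1, fun _ hy => hy.1.2⟩ hx

theorem phiPlus_eq_iInf (hpos : ∀ n θ, 0 ≤ upper ω f n θ) (hq : IsQpfMap ω X f)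
    (hc : IsMonotoneConcave X f) (hP : SatisfiesEstimates X f P) (θ : Torus d) :
    phiPlus ω f θ = ⨅ n, upper ω f n θ := by
  have hmem := mem_fibre_of_invariant (iInf_upper_mem_Icc hpos) (iInf_upper_invariant hpos hq hc hP)
  exact le_antisymm (csSup_le ⟨_, hmem θ⟩ fun x hx => le_ciInf fun n => fibre_le_upper hq hx n)
    (le_phiPlus θ (hmem θ))

theorem upperSemicontinuous_phiPlus (hpos : ∀ n θ, 0 ≤ upper ω f n θ) (hq : IsQpfMap ω X f)
    (hc : IsMonotoneConcave X f) (hP : SatisfiesEstimates X f P) :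
    UpperSemicontinuous (phiPlus ω f) := by
  rw [funext (phiPlus_eq_iInf hpos hq hc hP)]
  exact upperSemicontinuous_ciInf (fun θ => ⟨0, by rintro _ ⟨n, rfl⟩; exact hpos n θ⟩)
    fun n => (continuous_upper hq hP n).upperSemicontinuous

theorem phiPlus_mem_Icc (hpos : ∀ n θ, 0 ≤ upper ω f n θ) (hq : IsQpfMap ω X f)
    (hc : IsMonotoneConcave X f) (hP : SatisfiesEstimates X f P) (θ : Torus d) :
    phiPlus ω f θ ∈ Icc (0 : ℝ) 1 := by
  rw [phiPlus_eq_iInf hpos hq hc hP]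
  exact iInf_upper_mem_Icc hpos θ

theorem phiPlus_invariant (hpos : ∀ n θ, 0 ≤ upper ω f n θ) (hq : IsQpfMap ω X f)
    (hc : IsMonotoneConcave X f) (hP : SatisfiesEstimates X f P) (θ : Torus d) :
    f θ (phiPlus ω f θ) = phiPlus ω f (θ + ω) := by
  simp only [phiPlus_eq_iInf hpos hq hc hP]
  exact iInf_upper_invariant hpos hq hc hP θ

theorem isInvariantGraph_phiPlus (hpos : ∀ n θ, 0 ≤ upper ω f n θ) (hq : IsQpfMap ω X f)
    (hc : IsMonotoneConcave X f) (hP : SatisfiesEstimates X f P) :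
    IsInvariantGraph ω X f (phiPlus ω f) where
  measurable := (upperSemicontinuous_phiPlus hpos hq hc hP).measurable
  mem θ := hq.unit_subset (phiPlus_mem_Icc hpos hq hc hP θ)
  invariant := phiPlus_invariant hpos hq hc hP

end Iterates

/-! ### Combinatorics of the visits to the critical regions -/

/-- The slow recurrence conditions at all levels, in terms of the times at which an orbit visits the
critical regions. -/
structure SlowRecurrence {d : ℕ} (ω : Torus d) (f : Torus d → ℝ → ℝ) (P : Constants d) : Prop where
  nonempty : ∀ j, (critRegion ω f P j).Nonempty
  sep : ∀ (j : ℕ) (θ : Torus d) (s t : ℤ), θ - s • ω ∈ critRegion ω f P j →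
    θ - t • ω ∈ critRegion ω f P j → s < t → 2 * (P.K j : ℤ) * P.M j < t - s
  right : ∀ (i j : ℕ) (θ : Torus d) (s t : ℤ), i < j → θ - s • ω ∈ critRegion ω f P i →
    θ - t • ω ∈ critRegion ω f P j →
      ¬(s - (P.M i + 1) ≤ t - (P.M j + 1) ∧ t - (P.M j + 1) ≤ s + P.M i - 1)
  left : ∀ (i j : ℕ) (θ : Torus d) (s t : ℤ), i < j → θ - s • ω ∈ critRegion ω f P i →
    θ - t • ω ∈ critRegion ω f P j →
      ¬(s - (P.M i + 1) ≤ t + (P.M j - 1) ∧ t + (P.M j - 1) ≤ s + P.M i - 1)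

section KeyLemma

variable {d : ℕ} {ω : Torus d} {X : Set ℝ} {f : Torus d → ℝ → ℝ} {P : Constants d}

theorem mem_regionV_union_regionW {i j : ℕ} (hij : i < j) {θ : Torus d} {l : ℤ}
    (h1 : -((P.M i : ℤ) - 1) ≤ l) (h2 : l ≤ (P.M i : ℤ) + 1)
    (hθ : θ - l • ω ∈ critRegion ω f P i) : θ ∈ regionV ω f P j ∪ regionW ω f P j := by
  rcases lt_or_ge 0 l with h | h
  · exact Or.inl (mem_biUnion (mem_Iio.2 hij) (mem_biUnion (mem_Icc.2 ⟨by omega, h2⟩)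
      (mem_shift.2 hθ)))
  · exact Or.inr (mem_biUnion (mem_Iio.2 hij) (mem_biUnion (mem_Icc.2 ⟨h1, h⟩) (mem_shift.2 hθ)))

/-- A positive distance is used as disjointness from the translates. The translates in `regionV` and
`regionW` together are those by `l` with `-(M_i - 1) ≤ l ≤ M_i + 1`. -/
theorem slowRecurrence (hF : ∀ n ≥ 1, CondF ω f P n) : SlowRecurrence ω f P := by
  have hF' : ∀ j, _ := fun j => hF (j + 1) (by omega) j (by omega)
  refine ⟨fun j => (hF' j).1, ?_, ?_, ?_⟩
  · intro j θ s t hs ht hst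
    by_contra! hle
    obtain ⟨k, hk⟩ := Int.eq_ofNat_of_zero_le (sub_nonneg.2 hst.le)
    have hmem : θ - s • ω ∈ ⋃ k ∈ Icc 1 (2 * P.K j * P.M j),
        shift ω (k : ℤ) (critRegion ω f P j) := by
      refine mem_biUnion (mem_Icc.2 ⟨by omega, by zify; omega⟩) (mem_shift.2 ?_ : _ ∈ shift ω (k : ℤ) _)
      have : θ - s • ω - (k : ℤ) • ω = θ - t • ω := by
        rw [sub_sub, ← add_smul, ← hk, add_sub_cancel]
      rwa [this]
    have h0 : setDist (critRegion ω f P j) (⋃ k ∈ Icc 1 (2 * P.K j * P.M j),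
        shift ω (k : ℤ) (critRegion ω f P j)) ≤ edist (θ - s • ω) (θ - s • ω) :=
      (iInf₂_le _ hs).trans (iInf₂_le _ hmem)
    rw [edist_self] at h0
    exact absurd (hF' j).2.1 (not_lt.2 (h0.trans zero_le))
  · rintro i j θ s t hij hs ht ⟨h1, h2⟩
    refine (eq_empty_iff_forall_notMem.1 (hF' j).2.2) (θ - (t - (P.M j + 1)) • ω) ⟨Or.inr ?_, ?_⟩
    · rw [mem_shift, sub_sub, ← add_smul, sub_add_cancel]
      exact ht
    · refine mem_regionV_union_regionW hij (l := s - (t - (P.M j + 1))) (by omega) (by omega) ?_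
      rw [sub_sub, ← add_smul, add_sub_cancel]
      exact hs
  · rintro i j θ s t hij hs ht ⟨h1, h2⟩
    refine (eq_empty_iff_forall_notMem.1 (hF' j).2.2) (θ - (t + (P.M j - 1)) • ω) ⟨Or.inl ?_, ?_⟩
    · rw [mem_shift, sub_sub, ← add_smul]
      rwa [show t + ((P.M j : ℤ) - 1) + -((P.M j : ℤ) - 1) = t by ring]
    · refine mem_regionV_union_regionW hij (l := s - (t + (P.M j - 1))) (by omega) (by omega) ?_
      rw [sub_sub, ← add_smul, add_sub_cancel]
      exact hs

/-- If the pullback of the line `x = 1` is below `C`, then a critical region has been visited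
recently. -/
theorem exists_visit_of_upper_lt (hq : IsQpfMap ω X f) (hc : IsMonotoneConcave X f)
    (hP : SatisfiesEstimates X f P) (hR : SlowRecurrence ω f P) (hMn : ∀ n, n ≤ P.M n)
    (hpos : ∀ n θ, 0 ≤ upper ω f n θ) (n : ℕ) (θ : Torus d) (h : upper ω f n θ < P.c) :
    ∃ m k : ℕ, 1 ≤ m ∧ m ≤ n ∧ m ≤ P.M k + 1 ∧ θ - (m : ℤ) • ω ∈ critRegion ω f P k := by
  induction n using Nat.strong_induction_on generalizing θ with
  | _ n IH =>
  -- the orbit segment that ends in the point under consideration, with reversed time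
  set a : ℕ → ℝ := fun t => upper ω f (n - t) (θ - (t : ℤ) • ω) with ha
  have haX : ∀ t, a t ∈ X := fun t => upper_mem hq _ _
  have ha1 : ∀ t, a t ≤ 1 := fun t => upper_le_one hq hc _ _
  have hiter : ∀ s t : ℕ, t + s ≤ n →
      iter ω f s (θ - ((t + s : ℕ) : ℤ) • ω) (a (t + s)) = a t := by
    intro s t hst
    simp only [ha]
    rw [iter_upper]
    congr 1
    · omega
    · push_cast
      rw [add_smul, natCast_zsmul ω s]
      abel
  have hstep : ∀ t : ℕ, t + 1 ≤ n → a t = f (θ - ((t + 1 : ℕ) : ℤ) • ω) (a (t + 1)) := by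
    intro t ht
    have := hiter 1 t ht
    rw [iter_succ] at this
    simpa using this.symm
  have hI0 : ∀ t : ℕ, t + 1 ≤ n → a t < P.c → P.e ≤ a (t + 1) →
      θ - ((t + 1 : ℕ) : ℤ) • ω ∈ critRegion ω f P 0 := by
    intro t ht hlt hge
    by_contra hno
    have := (hP.maps_to_C _ hno (a (t + 1)) ⟨hge, ha1 _⟩).1
    rw [← hstep t ht] at this
    exact absurd hlt (not_lt.2 this)
  have hex : ∃ t, P.c ≤ a t := ⟨n, by simp [ha, hP.c_lt_one.le]⟩
  classical
  -- The most recent time at which the segment was in `C`; it exists since the segment starts at 1.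
  -- Leaving `C` is only possible over the first critical region.
  set m := Nat.find hex with hm
  have hmc : P.c ≤ a m := Nat.find_spec hex
  have hlow : ∀ t < m, a t < P.c := fun t ht => not_le.1 (Nat.find_min hex ht)
  have hmn : m ≤ n := Nat.find_min' hex (by simp [ha, hP.c_lt_one.le])
  have hm1 : 1 ≤ m := by
    by_contra! h0
    have h0' : m = 0 := by omega
    rw [h0'] at hmc
    have : a 0 = upper ω f n θ := by simp [ha]
    linarith
  have hmI : θ - (m : ℤ) • ω ∈ critRegion ω f P 0 := by
    have := hI0 (m - 1) (by omega) (hlow _ (by omega))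
      (by rw [Nat.sub_add_cancel hm1]; exact hP.e_lt_c.le.trans hmc)
    rwa [Nat.sub_add_cancel hm1] at this
  -- climb through the levels of the critical regions
  have climb : ∀ q k T : ℕ, n ≤ k + q → m ≤ T → T ≤ n → T < m + P.M k + 1 →
      θ - (T : ℤ) • ω ∈ critRegion ω f P k →
      ∃ m k : ℕ, 1 ≤ m ∧ m ≤ n ∧ m ≤ P.M k + 1 ∧ θ - (m : ℤ) • ω ∈ critRegion ω f P k := by
    -- The level `k` increases at each stage and `k ≤ M_k < T ≤ n` unless the climb is finished, so
    -- `q` measures the levels still available.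
    intro q
    induction q using Nat.strong_induction_on with
    | _ q IHq =>
    intro k T hkq hmT hTn hTk hT
    have hMk := two_le_M hP k
    have hkM := hMn k
    by_cases hdone : T ≤ P.M k + 1
    · exact ⟨T, k, hm1.trans hmT, hTn, hdone, hT⟩
    push Not at hdone
    obtain ⟨t₀, rfl⟩ : ∃ t₀, T = t₀ + (P.M k + 1) := ⟨T - (P.M k + 1), by omega⟩
    have ht₀ : a t₀ < P.c := hlow _ (by omega)
    -- Slow recurrence: `M_k + 1` steps after a visit to level `k` the orbit is not over level 0.
    -- This forces the low value `a t₀` below `e`, since otherwise its successor would lie in `C`.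
    have hno : θ - (t₀ : ℤ) • ω ∉ critRegion ω f P 0 := by
      intro hmem
      rcases Nat.eq_zero_or_pos k with rfl | hk
      · have := hR.sep 0 θ t₀ _ hmem hT (by push_cast; omega)
        have hK := K_pos hP 0
        push_cast at this
        have : (2 : ℤ) * P.M 0 ≤ 2 * P.K 0 * P.M 0 := by
          have : P.M 0 ≤ P.K 0 * P.M 0 := Nat.le_mul_of_pos_left _ hK
          zify at this
          linarith
        omega
      · have hM0 := two_le_M hP 0
        refine hR.right 0 k θ t₀ _ hk hmem hT ⟨?_, ?_⟩ <;> push_cast <;> omega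
    have hE : a t₀ < P.e := by
      by_contra! hge
      obtain ⟨t, rfl⟩ : ∃ t, t₀ = t + 1 := ⟨t₀ - 1, by omega⟩
      exact hno (hI0 t (by omega) (hlow t (by omega)) hge)
    have hit := hiter (P.M k + 1) t₀ hTn
    -- A start `y` in `C` whose orbit stays below the given one and above 0 also ends in `E` at time
    -- `t₀`. So the visit at time `T` is one to level `k + 1`.
    have key : ∀ y ∈ P.C, (iter ω f (P.M k - 1)
        (θ - ((t₀ + (P.M k + 1) : ℕ) : ℤ) • ω - (P.M k - 1) • ω) y ≤ a (t₀ + (P.M k + 1))) →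
        0 ≤ iter ω f (P.M k + 1) (θ - ((t₀ + (P.M k + 1) : ℕ) : ℤ) • ω) (iter ω f (P.M k - 1)
        (θ - ((t₀ + (P.M k + 1) : ℕ) : ℤ) • ω - (P.M k - 1) • ω) y) →
        ∃ m k : ℕ, 1 ≤ m ∧ m ≤ n ∧ m ≤ P.M k + 1 ∧ θ - (m : ℤ) • ω ∈ critRegion ω f P k := by
      intro y hy hle h0
      have hMk1 : P.M k ≤ P.M (k + 1) :=
        (Nat.le_mul_of_pos_left _ (K_pos hP k)).trans (hP.M_lower k)
      refine IHq (q - 1) ?_ (k + 1) _ (by omega) hmT hTn (by omega)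
        ((mem_critRegion_succ hP).2 ⟨hT, y, hy, h0, ?_⟩)
      · omega
      · refine le_trans (iter_mono hq _ _ (iter_mem hq _ _ (C_subset hq hP hy)) (haX _) hle) ?_
        rw [hit]
        exact hE.le
    -- If the history before `T` is no longer than `M_k - 1`, start from 1 exactly `M_k - 1` steps
    -- back: the pullbacks decrease, so this orbit is below the given one.
    rcases le_or_gt (n - (t₀ + (P.M k + 1))) (P.M k - 1) with hA | hB
    · refine key 1 (one_mem_C hP) ?_ ?_
      · exact upper_antitone hq hc _ hA
      · change 0 ≤ iter ω f _ _ (upper ω f (P.M k - 1) _)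
        rw [iter_upper]
        exact hpos _ _
    · have hBn : t₀ + (P.M k + 1) + (P.M k - 1) ≤ n := by omega
      have hit2 := hiter (P.M k - 1) (t₀ + (P.M k + 1)) hBn
      have hpt : θ - ((t₀ + (P.M k + 1) + (P.M k - 1) : ℕ) : ℤ) • ω =
          θ - ((t₀ + (P.M k + 1) : ℕ) : ℤ) • ω - (P.M k - 1) • ω := by
        rw [sub_sub, ← natCast_zsmul ω (P.M k - 1), ← add_smul]
        congr 2
      rw [hpt] at hit2
      by_cases hy : P.c ≤ a (t₀ + (P.M k + 1) + (P.M k - 1))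
      · refine key _ ⟨hy, ha1 _⟩ hit2.le ?_
        rw [hit2, hit]
        exact hpos _ _
      · push Not at hy
        -- The point `M_k - 1` steps before `T` is below `C` and has a shorter history, hence has
        -- its own recent visit. Slow recurrence makes its level exceed `k`, and the climb restarts
        -- there; `hright` ensures that this visit is still close enough to `m`.
        obtain ⟨m', k', h1, h2, h3, h4⟩ := IH _ (by omega) _ hy
        rw [sub_sub, ← add_smul] at h4
        have hkk' : k < k' := by
          by_contra! hle
          have hcast : ((P.M k - 1 : ℕ) : ℤ) = (P.M k : ℤ) - 1 := by omega
          rcases hle.lt_or_eq with hlt | rfl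
          · refine hR.left k' k θ _ _ hlt h4 hT ⟨?_, ?_⟩ <;> push_cast <;> omega
          · have := hR.sep k' θ _ _ hT h4 (by push_cast; omega)
            have hK := K_pos hP k'
            have : (2 : ℤ) * P.M k' ≤ 2 * P.K k' * P.M k' := by
              have : P.M k' ≤ P.K k' * P.M k' := Nat.le_mul_of_pos_left _ hK
              zify at this
              linarith
            push_cast at *
            omega
        have hcast : ((P.M k - 1 : ℕ) : ℤ) = (P.M k : ℤ) - 1 := by omega
        have hright := hR.right k k' θ _ _ hkk' hT h4
        refine IHq (q - 1) ?_ k' (t₀ + (P.M k + 1) + (P.M k - 1) + m') (by omega) (by omega)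
          (by omega) ?_ (by push_cast at h4 ⊢; exact h4)
        · omega
        · by_contra! hcon
          refine hright ⟨?_, ?_⟩ <;> push_cast <;> omega
  exact climb n 0 m (by omega) le_rfl hmn (by omega) hmI

end KeyLemma

section Counting

variable {d : ℕ} {ω : Torus d} {X : Set ℝ} {f : Torus d → ℝ → ℝ} {P : Constants d}

/-! ### Arithmetic of the constants -/

theorem p_sq_ge (hP : SatisfiesEstimates X f P) : 2 ≤ P.p ^ 2 := by
  have h := hP.sqrt_two_le_p
  nlinarith [Real.sq_sqrt (show (0 : ℝ) ≤ 2 by norm_num), Real.sqrt_nonneg 2]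

theorem p_pos (hP : SatisfiesEstimates X f P) : 0 < P.p :=
  (Real.sqrt_pos.2 (by norm_num)).trans_le hP.sqrt_two_le_p

theorem b_pos (hP : SatisfiesEstimates X f P) : 0 < P.b :=
  (Real.sqrt_nonneg _).trans_lt hP.b_large

/-- From `(1 - a)(1 + s + a) ≤ 1 + s` one gets `b (1 + s) ≤ 1` for the partial sums `s`. Squaring,
the lower bound on `b` gives `1 + 2s ≤ (1 + s)² ≤ (p² + 2)/(p² + 1)`. -/
theorem sum_inv_K_le (hP : SatisfiesEstimates X f P) (n : ℕ) :
    ∑ i ∈ Finset.range n, 1 / (P.K i : ℝ) ≤ 1 / (2 * (P.p ^ 2 + 1)) := by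
  have hK : ∀ i, (1 : ℝ) ≤ P.K i := fun i => by exact_mod_cast K_pos hP i
  have hK1 : ∀ i, 1 / (P.K i : ℝ) ≤ 1 := fun i => by
    rw [div_le_one (by linarith [hK i])]; exact hK i
  have hK0 : ∀ i, 0 ≤ 1 / (P.K i : ℝ) := fun i => by positivity
  have hnonneg : ∀ n, 0 ≤ P.bSeq n := by
    intro n
    induction n with
    | zero => exact zero_le_one
    | succ n ih => exact mul_nonneg (by linarith [hK1 n]) ih
  have hanti : Antitone P.bSeq := antitone_nat_of_succ_le fun n => by
    rw [Constants.bSeq]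
    nlinarith [hnonneg n, hK0 n]
  have hb : ∀ n, P.b ≤ P.bSeq n := hanti.le_of_tendsto hP.b_lim
  have hprod : ∀ n, P.bSeq n * (1 + ∑ i ∈ Finset.range n, 1 / (P.K i : ℝ)) ≤ 1 := by
    intro n
    induction n with
    | zero => simp [Constants.bSeq]
    | succ n ih =>
      rw [Constants.bSeq, Finset.sum_range_succ]
      set a := 1 / (P.K n : ℝ)
      set s := ∑ i ∈ Finset.range n, 1 / (P.K i : ℝ)
      have ha : 0 ≤ a := hK0 n
      have hs : 0 ≤ s := Finset.sum_nonneg fun i _ => hK0 i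
      have : (1 - a) * (1 + (s + a)) ≤ 1 + s := by nlinarith
      calc (1 - a) * P.bSeq n * (1 + (s + a)) = P.bSeq n * ((1 - a) * (1 + (s + a))) := by ring
        _ ≤ P.bSeq n * (1 + s) := mul_le_mul_of_nonneg_left this (hnonneg n)
        _ ≤ 1 := ih
  set s := ∑ i ∈ Finset.range n, 1 / (P.K i : ℝ)
  have hs : 0 ≤ s := Finset.sum_nonneg fun i _ => hK0 i
  have h1 : P.b * (1 + s) ≤ 1 :=
    (mul_le_mul_of_nonneg_right (hb n) (by linarith)).trans (hprod n)
  have hp := p_sq_ge hP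
  have hb0 := b_pos hP
  have h2 : (P.p ^ 2 + 1) / (P.p ^ 2 + 2) < P.b ^ 2 := by
    have := (Real.sqrt_lt' hb0).1 hP.b_large
    exact this
  rw [div_lt_iff₀ (by linarith)] at h2
  have h3 : P.b ^ 2 * (1 + s) ^ 2 ≤ 1 := by
    rw [← mul_pow]
    exact pow_le_one₀ (by positivity) h1
  have h4 : (P.p ^ 2 + 1) * (1 + s) ^ 2 ≤ P.p ^ 2 + 2 := by
    calc (P.p ^ 2 + 1) * (1 + s) ^ 2 ≤ P.b ^ 2 * (P.p ^ 2 + 2) * (1 + s) ^ 2 :=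
          mul_le_mul_of_nonneg_right h2.le (by positivity)
      _ = (P.p ^ 2 + 2) * (P.b ^ 2 * (1 + s) ^ 2) := by ring
      _ ≤ (P.p ^ 2 + 2) * 1 := mul_le_mul_of_nonneg_left h3 (by positivity)
      _ = _ := mul_one _
  rw [le_div_iff₀ (by positivity)]
  nlinarith [mul_nonneg (by positivity : 0 ≤ P.p ^ 2 + 1) (sq_nonneg s)]

theorem six_le_K (hP : SatisfiesEstimates X f P) (n : ℕ) : 6 ≤ P.K n := by
  have h1 := sum_inv_K_le hP (n + 1)
  have h2 : 1 / (P.K n : ℝ) ≤ ∑ i ∈ Finset.range (n + 1), 1 / (P.K i : ℝ) :=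
    Finset.single_le_sum (f := fun i => 1 / (P.K i : ℝ)) (fun i _ => by positivity)
      (Finset.self_mem_range_succ n)
  have h3 : (1 : ℝ) / (2 * (P.p ^ 2 + 1)) ≤ 1 / 6 :=
    one_div_le_one_div_of_le (by norm_num) (by linarith [p_sq_ge hP])
  have hK : (0 : ℝ) < P.K n := by exact_mod_cast K_pos hP n
  have := le_of_one_div_le_one_div hK (h2.trans (h1.trans h3))
  exact_mod_cast this

theorem six_mul_M_le (hP : SatisfiesEstimates X f P) (n : ℕ) : 6 * P.M n ≤ P.M (n + 1) :=
  (Nat.mul_le_mul_right _ (six_le_K hP n)).trans (hP.M_lower n)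

theorem M_strictMono (hP : SatisfiesEstimates X f P) : StrictMono P.M :=
  strictMono_nat_of_lt_succ fun n => by
    have := six_mul_M_le hP n
    have := two_le_M hP n
    omega

theorem tendsto_M (hP : SatisfiesEstimates X f P) : Tendsto P.M atTop atTop :=
  (M_strictMono hP).tendsto_atTop

theorem sum_M_le (hP : SatisfiesEstimates X f P) (n : ℕ) :
    ∑ i ∈ Finset.range (n + 1), P.M i ≤ 2 * P.M n := by
  induction n with
  | zero => simp; omega
  | succ n ih =>
    rw [Finset.sum_range_succ]
    have := six_mul_M_le hP n
    omega

theorem twelve_mul_M_le (hP : SatisfiesEstimates X f P) (n : ℕ) :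
    12 * P.M n ≤ 2 * P.K n * P.M n :=
  Nat.mul_le_mul_right _ (by have := six_le_K hP n; omega)

/-! ### Frequency of the visits -/

theorem card_separated_le {S : Finset ℕ} {g L : ℕ} (hg : 0 < g) (hS : ∀ h ∈ S, h ≤ L)
    (hsep : ∀ h ∈ S, ∀ h' ∈ S, h < h' → g < h' - h) : S.card ≤ L / g + 1 := by
  rw [← Finset.card_range (L / g + 1)]
  refine Finset.card_le_card_of_injOn (fun h => h / g) (fun h hh => ?_) ?_
  · exact Finset.mem_coe.2 (Finset.mem_range_succ_iff.2 (Nat.div_le_div_right (hS h hh)))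
  · have key : ∀ h ∈ S, ∀ h' ∈ S, h < h' → h / g ≠ h' / g := by
      intro h hh h' hh' hlt heq
      have h1 := hsep h hh h' hh' hlt
      have h2 : (h + g) / g ≤ h' / g := Nat.div_le_div_right (by omega)
      rw [Nat.add_div_right _ hg] at h2
      omega
    intro h hh h' hh' heq
    rcases lt_trichotomy h h' with hlt | rfl | hlt
    · exact absurd heq (key h hh h' hh' hlt)
    · rfl
    · exact absurd heq.symm (key h' hh' h hh hlt)

open Classical in
/-- The times in `[1, N]` (counted backwards) at which the orbit of `θ` has visited the `k`-th
critical region within the previous `M_k + 1` steps. -/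
noncomputable def visitTimes (ω : Torus d) (f : Torus d → ℝ → ℝ) (P : Constants d) (θ : Torus d)
    (k N : ℕ) : Finset ℕ :=
  (Finset.Icc 1 N).filter fun n =>
    ∃ m : ℕ, 1 ≤ m ∧ m ≤ P.M k + 1 ∧ θ - ((n + m : ℕ) : ℤ) • ω ∈ critRegion ω f P k

/-- Visits are more than `g = 2 K_k M_k` apart and each spoils at most `M_k + 1` times, a proportion
of at most `(3/4)/K_k` because `M_k ≥ 2`. The additive term accounts for the two ends of the time
window. -/
theorem card_visitTimes_le (hP : SatisfiesEstimates X f P) (hR : SlowRecurrence ω f P)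
    (θ : Torus d) (k N : ℕ) :
    ((visitTimes ω f P θ k N).card : ℝ) ≤ 3 / 4 * N * (1 / P.K k) + 3 * P.M k := by
  classical
  set g := 2 * P.K k * P.M k with hg
  have hM := two_le_M hP k
  have hK := K_pos hP k
  have hgM := twelve_mul_M_le hP k
  set S : Finset ℕ := (Finset.Icc 1 (N + (P.M k + 1))).filter fun h =>
    θ - (h : ℤ) • ω ∈ critRegion ω f P k with hS
  have hScard : S.card ≤ (N + (P.M k + 1)) / g + 1 := by
    refine card_separated_le (by omega) (fun h hh => ?_) fun h hh h' hh' hlt => ?_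
    · exact (Finset.mem_Icc.1 (Finset.mem_filter.1 hh).1).2
    · have := hR.sep k θ h h' (Finset.mem_filter.1 hh).2 (Finset.mem_filter.1 hh').2
        (by exact_mod_cast hlt)
      zify [hlt.le]
      rw [hg]
      push_cast
      exact this
  have hsub : visitTimes ω f P θ k N ⊆ S.biUnion fun h => Finset.Ico (h - (P.M k + 1)) h := by
    intro n hn
    obtain ⟨hn1, m, h1, h2, h3⟩ := Finset.mem_filter.1 hn
    rw [Finset.mem_Icc] at hn1
    refine Finset.mem_biUnion.2 ⟨n + m, Finset.mem_filter.2 ⟨Finset.mem_Icc.2 (by omega), h3⟩,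
      Finset.mem_Ico.2 (by omega)⟩
  have hcard : (visitTimes ω f P θ k N).card ≤ S.card * (P.M k + 1) :=
    (Finset.card_le_card hsub).trans (Finset.card_biUnion_le_card_mul _ _ _ fun h _ => by
      rw [Nat.card_Ico]; omega)
  have hgr : (0 : ℝ) < g := by exact_mod_cast (show 0 < g by omega)
  have hMr : (2 : ℝ) ≤ P.M k := by exact_mod_cast hM
  have hKr : (0 : ℝ) < P.K k := by exact_mod_cast hK
  have h1 : (S.card : ℝ) ≤ N / g + 2 := by
    have h2 : (S.card : ℝ) ≤ ((N + (P.M k + 1) : ℕ) : ℝ) / g + 1 :=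
      (Nat.cast_le.2 hScard).trans (by
        push_cast
        have := Nat.cast_div_le (α := ℝ) (m := N + (P.M k + 1)) (n := g)
        push_cast at this
        linarith)
    have h3 : ((P.M k + 1 : ℕ) : ℝ) / g ≤ 1 := by
      rw [div_le_one hgr]
      exact_mod_cast (show P.M k + 1 ≤ g by omega)
    push_cast at h2 h3
    rw [add_div] at h2
    linarith
  have h4 : (P.M k + 1 : ℝ) / g ≤ 3 / 4 * (1 / P.K k) := by
    rw [hg]
    push_cast
    rw [div_le_iff₀ (by positivity)]
    have : 3 / 4 * (1 / (P.K k : ℝ)) * (2 * P.K k * P.M k) = 3 / 2 * P.M k := by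
      field_simp
      ring
    rw [this]
    linarith
  calc ((visitTimes ω f P θ k N).card : ℝ) ≤ S.card * (P.M k + 1) := by exact_mod_cast hcard
    _ ≤ (N / g + 2) * (P.M k + 1) := mul_le_mul_of_nonneg_right h1 (by positivity)
    _ = N * ((P.M k + 1) / g) + 2 * (P.M k + 1) := by ring
    _ ≤ N * (3 / 4 * (1 / P.K k)) + 3 * P.M k :=
        add_le_add (mul_le_mul_of_nonneg_left h4 (Nat.cast_nonneg _)) (by linarith)
    _ = _ := by ring

/-! ### Contraction along the upper bounding graph -/

/-- Iterated linear recursion; every error `e` is amplified by at most `A ^ N`. -/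
theorem le_prod_add {D L : ℕ → ℝ} {A e : ℝ} (hA : 1 ≤ A) (he : 0 ≤ e) (hL0 : ∀ n, 0 ≤ L n)
    (hLA : ∀ n, L n ≤ A) (hD : ∀ n, D n ≤ L n * D (n + 1) + e) (N : ℕ) :
    D 0 ≤ (∏ i ∈ Finset.range N, L i) * D N + N * e * A ^ N := by
  induction N with
  | zero => simp
  | succ N ih =>
    have hp0 : 0 ≤ ∏ i ∈ Finset.range N, L i := Finset.prod_nonneg fun i _ => hL0 i
    have hp : ∏ i ∈ Finset.range N, L i ≤ A ^ N := by
      have := Finset.prod_le_prod (s := Finset.range N) (fun i _ => hL0 i) (fun i _ => hLA i)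
      simpa using this
    have hAN : A ^ N ≤ A ^ (N + 1) := pow_le_pow_right₀ hA (Nat.le_succ N)
    calc D 0 ≤ (∏ i ∈ Finset.range N, L i) * D N + N * e * A ^ N := ih
      _ ≤ (∏ i ∈ Finset.range N, L i) * (L N * D (N + 1) + e) + N * e * A ^ N := by
          gcongr
          exact hD N
      _ = (∏ i ∈ Finset.range (N + 1), L i) * D (N + 1) +
          ((∏ i ∈ Finset.range N, L i) * e + N * e * A ^ N) := by
          rw [Finset.prod_range_succ]; ring
      _ ≤ (∏ i ∈ Finset.range (N + 1), L i) * D (N + 1) +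
          (A ^ (N + 1) * e + N * e * A ^ (N + 1)) := by
          gcongr
          exact hp.trans hAN
      _ = _ := by push_cast; ring

open Classical in
/-- The upper bounding graph over `θ` exceeds the one over a nearby point `θ'` by little, if the
latter one is in `C` for most of the last `N` steps. -/
theorem phiPlus_sub_le (hq : IsQpfMap ω X f) (hc : IsMonotoneConcave X f)
    (hP : SatisfiesEstimates X f P) (hpos : ∀ n θ, 0 ≤ upper ω f n θ) (θ θ' : Torus d) (N : ℕ) :
    phiPlus ω f θ - phiPlus ω f θ' ≤
      P.α ^ (-(2 / P.p) * N + (P.p + 2 / P.p) *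
        ((Finset.Icc 1 N).filter fun n : ℕ => phiPlus ω f (θ' - (n : ℤ) • ω) < P.c).card) +
      N * (P.S * dist θ θ') * (P.α ^ P.p) ^ N := by
  set x : ℕ → ℝ := fun n => phiPlus ω f (θ - (n : ℤ) • ω) with hx
  set u : ℕ → ℝ := fun n => phiPlus ω f (θ' - (n : ℤ) • ω) with hu
  have hstep : ∀ (ϑ : Torus d) (n : ℕ), phiPlus ω f (ϑ - (n : ℤ) • ω) =
      f (ϑ - ((n + 1 : ℕ) : ℤ) • ω) (phiPlus ω f (ϑ - ((n + 1 : ℕ) : ℤ) • ω)) := by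
    intro ϑ n
    rw [phiPlus_invariant hpos hq hc hP]
    congr 1
    push_cast
    rw [add_smul, one_smul]
    abel
  have hmem := phiPlus_mem_Icc hpos hq hc hP
  have hmemX : ∀ ϑ, phiPlus ω f ϑ ∈ X := fun ϑ => hq.unit_subset (hmem ϑ)
  have hα := hP.one_lt_α
  have hα0 := hP.α_pos
  have hp := p_pos hP
  set D : ℕ → ℝ := fun n => max (x n - u n) 0 with hD
  set L : ℕ → ℝ := fun n => if u (n + 1) < P.c then P.α ^ P.p else P.α ^ (-(2 / P.p)) with hL
  have hL0 : ∀ n, 0 ≤ L n := fun n => by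
    simp only [hL]; split_ifs <;> exact Real.rpow_nonneg hα0.le _
  have hLA : ∀ n, L n ≤ P.α ^ P.p := fun n => by
    simp only [hL]
    split_ifs
    · exact le_rfl
    · refine Real.rpow_le_rpow_of_exponent_le hα.le ?_
      have : 0 < 2 / P.p := by positivity
      linarith
  have he : 0 ≤ P.S * dist θ θ' := mul_nonneg hP.S_pos.le dist_nonneg
  have hrec : ∀ n, D n ≤ L n * D (n + 1) + P.S * dist θ θ' := by
    intro n
    have hD0 : 0 ≤ D (n + 1) := le_max_right _ _
    refine max_le ?_ (add_nonneg (mul_nonneg (hL0 n) hD0) he)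
    set ϑ := θ - ((n + 1 : ℕ) : ℤ) • ω with hϑ
    set ϑ' := θ' - ((n + 1 : ℕ) : ℤ) • ω with hϑ'
    have h1 : x n = f ϑ (x (n + 1)) := hstep θ n
    have h2 : u n = f ϑ' (u (n + 1)) := hstep θ' n
    have hd : dist ϑ ϑ' = dist θ θ' := dist_sub_right _ _ _
    have h3 : f ϑ (u (n + 1)) - f ϑ' (u (n + 1)) ≤ P.S * dist θ θ' := by
      rw [← hd]
      exact (le_abs_self _).trans (hP.lip_θ _ _ _ (hmemX _))
    have h4 : f ϑ (x (n + 1)) - f ϑ (u (n + 1)) ≤ L n * D (n + 1) := by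
      rcases le_or_gt (x (n + 1)) (u (n + 1)) with hle | hgt
      · have := hq.monotone ϑ (hmemX _) (hmemX _) hle
        have : 0 ≤ L n * D (n + 1) := mul_nonneg (hL0 n) hD0
        linarith
      · have hDe : D (n + 1) = |x (n + 1) - u (n + 1)| := by
          rw [abs_of_pos (by linarith)]
          exact max_eq_left (by linarith)
        rw [hDe]
        refine (le_abs_self _).trans ?_
        -- Only the lower orbit has to be tested: if `u (n + 1)` is in `C`, the larger `x (n + 1)`
        -- is in `C` as well and the contraction applies.
        by_cases hlow : u (n + 1) < P.c
        · simp only [hL, if_pos hlow]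
          exact (hP.lip_x ϑ _ (hmemX _) _ (hmemX _)).2
        · simp only [hL, if_neg hlow]
          push Not at hlow
          exact hP.lip_C ϑ _ ⟨hlow.trans hgt.le, (hmem _).2⟩ _ ⟨hlow, (hmem _).2⟩
    rw [h1, h2]
    linarith
  have hmain := le_prod_add (Real.one_le_rpow hα.le hp.le) he hL0 hLA hrec N
  have hDN : D N ≤ 1 := by
    refine max_le ?_ zero_le_one
    have := (hmem (θ - (N : ℤ) • ω)).2
    have := (hmem (θ' - (N : ℤ) • ω)).1
    simp only [hx, hu]
    linarith
  have hD0 : phiPlus ω f θ - phiPlus ω f θ' ≤ D 0 := by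
    refine le_trans (le_of_eq ?_) (le_max_left _ _)
    simp [hx, hu]
  have hprod : ∏ i ∈ Finset.range N, L i =
      P.α ^ (-(2 / P.p) * N + (P.p + 2 / P.p) *
        ((Finset.Icc 1 N).filter fun n : ℕ => phiPlus ω f (θ' - (n : ℤ) • ω) < P.c).card) := by
    clear hmain hDN
    induction N with
    | zero => simp
    | succ N ih =>
      have hIcc : Finset.Icc 1 (N + 1) = insert (N + 1) (Finset.Icc 1 N) := by
        ext n
        simp only [Finset.mem_Icc, Finset.mem_insert]
        omega
      rw [Finset.prod_range_succ, ih, hIcc, Finset.filter_insert]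
      have hnot : N + 1 ∉ (Finset.Icc 1 N).filter
          fun n : ℕ => phiPlus ω f (θ' - (n : ℤ) • ω) < P.c := by simp
      by_cases hlow : u (N + 1) < P.c
      · rw [if_pos hlow, Finset.card_insert_of_notMem hnot]
        simp only [hL, if_pos hlow]
        rw [← Real.rpow_add hα0]
        congr 1
        push_cast
        ring
      · rw [if_neg hlow]
        simp only [hL, if_neg hlow]
        rw [← Real.rpow_add hα0]
        congr 1
        push_cast
        ring
  rw [hprod] at hmain
  refine hD0.trans (hmain.trans ?_)
  gcongr
  exact mul_le_of_le_one_right (Real.rpow_nonneg hα0.le _) hDN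

open Classical in
/-- An orbit that avoids the critical regions of level above `j` in the recent past, and the one of
level `j` in a part of it, is in `C` most of the time. -/
theorem card_low_le (hq : IsQpfMap ω X f) (hc : IsMonotoneConcave X f)
    (hP : SatisfiesEstimates X f P) (hR : SlowRecurrence ω f P)
    (hpos : ∀ n θ, 0 ≤ upper ω f n θ) (θ : Torus d) (j N h₀ : ℕ) (hN : N ≤ P.M j)
    (hav : ∀ i > j, ∀ l : ℕ, 1 ≤ l → l ≤ 2 * P.K i * P.M i →
      θ - (l : ℤ) • ω ∉ critRegion ω f P i)
    (hnb : ∀ h : ℕ, h₀ ≤ h → h ≤ N + P.M j + 1 → θ - (h : ℤ) • ω ∉ critRegion ω f P j) :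
    (((Finset.Icc 1 N).filter fun n : ℕ => phiPlus ω f (θ - (n : ℤ) • ω) < P.c).card : ℝ) ≤
      3 / 8 * N * (1 / (P.p ^ 2 + 1)) + 3 * (∑ k ∈ Finset.range j, (P.M k : ℝ)) + h₀ := by
  have hsub : ((Finset.Icc 1 N).filter fun n : ℕ => phiPlus ω f (θ - (n : ℤ) • ω) < P.c) ⊆
      ((Finset.range j).biUnion fun k => visitTimes ω f P θ k N) ∪ Finset.range h₀ := by
    intro n hn
    obtain ⟨hn1, hn2⟩ := Finset.mem_filter.1 hn
    have hn1' := Finset.mem_Icc.1 hn1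
    rw [phiPlus_eq_iInf hpos hq hc hP] at hn2
    obtain ⟨s, hs⟩ := exists_lt_of_ciInf_lt hn2
    obtain ⟨m, k, h1, -, h2, h3⟩ := exists_visit_of_upper_lt hq hc hP hR
      (fun _ => (M_strictMono hP).le_apply) hpos s _ hs
    rw [sub_sub, ← add_smul, ← Nat.cast_add] at h3
    -- Levels below `j` are counted by `visitTimes`; at level `j` the visit, and so the time `n`, is
    -- earlier than `h₀` in backward time; a higher level is excluded because `n + m ≤ M_j + M_k + 1
    -- ≤ 2 K_k M_k`.
    rcases lt_trichotomy k j with hk | rfl | hk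
    · exact Finset.mem_union_left _ (Finset.mem_biUnion.2 ⟨k, Finset.mem_range.2 hk,
        Finset.mem_filter.2 ⟨hn1, m, h1, h2, h3⟩⟩)
    · refine Finset.mem_union_right _ (Finset.mem_range.2 ?_)
      by_contra! hge
      exact hnb (n + m) (by omega) (by omega) h3
    · refine absurd h3 (hav k hk (n + m) (by omega) ?_)
      have h4 := M_strictMono hP hk
      have h5 := twelve_mul_M_le hP k
      omega
  have h1 := Finset.card_le_card hsub
  have h2 : (((Finset.range j).biUnion fun k => visitTimes ω f P θ k N).card : ℝ) ≤
      ∑ k ∈ Finset.range j, (3 / 4 * N * (1 / P.K k) + 3 * P.M k : ℝ) := by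
    refine le_trans (Nat.cast_le.2 Finset.card_biUnion_le) ?_
    rw [Nat.cast_sum]
    exact Finset.sum_le_sum fun k _ => card_visitTimes_le hP hR θ k N
  rw [Finset.sum_add_distrib, ← Finset.mul_sum, ← Finset.mul_sum] at h2
  have h3 := sum_inv_K_le hP j
  have h4 : 3 / 4 * (N : ℝ) * ∑ k ∈ Finset.range j, 1 / (P.K k : ℝ) ≤
      3 / 8 * N * (1 / (P.p ^ 2 + 1)) := by
    calc 3 / 4 * (N : ℝ) * ∑ k ∈ Finset.range j, 1 / (P.K k : ℝ)
        ≤ 3 / 4 * (N : ℝ) * (1 / (2 * (P.p ^ 2 + 1))) :=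
          mul_le_mul_of_nonneg_left h3 (by positivity)
      _ = _ := by field_simp; ring
  have h5 := (h1.trans (Finset.card_union_le _ _))
  rw [Finset.card_range] at h5
  have h6 : (((Finset.Icc 1 N).filter fun n : ℕ =>
      phiPlus ω f (θ - (n : ℤ) • ω) < P.c).card : ℝ) ≤
      ((Finset.range j).biUnion fun k => visitTimes ω f P θ k N).card + h₀ := by exact_mod_cast h5
  linarith

end Counting

section Approximation

variable {d : ℕ} {ω : Torus d} {X : Set ℝ} {f : Torus d → ℝ → ℝ} {P : Constants d}

theorem Diophantine.pos_dim {ω : Torus d} (hω : Diophantine ω) : 0 < d := by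
  rcases Nat.eq_zero_or_pos d with rfl | h
  · obtain ⟨C, η, hC, -, h⟩ := hω
    have h1 := h 1 one_ne_zero
    rw [Subsingleton.elim ((1 : ℤ) • ω) 0, dist_self] at h1
    simp at h1
    linarith
  · exact h

/-! ### Growth of the constants -/

/-- `K_{k+1} = κ K_k` and `K_k ≤ M_{k+1}`. Hence the next scale is at most a constant times the
square of the present one, so waiting times grow polynomially in `M_k` while the regions shrink
exponentially. -/
theorem K_le (hP : SatisfiesEstimates X f P) (k : ℕ) : P.K k ≤ P.κ * P.K₀ * P.M k := by
  have hκ := hP.two_le_κ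
  cases k with
  | zero =>
    have := two_le_M hP 0
    calc P.K 0 = 1 * P.K₀ * 1 := by simp [Constants.K]
      _ ≤ _ := by gcongr <;> omega
  | succ k =>
    have h1 := hP.M_lower k
    have h2 := two_le_M hP k
    have h3 := hP.one_le_K₀
    calc P.K (k + 1) = P.κ * 1 * (P.K k * 1) := by simp only [Constants.K, pow_succ]; ring
      _ ≤ P.κ * P.K₀ * (P.K k * P.M k) := by gcongr; omega
      _ ≤ _ := by gcongr

theorem M_succ_le (hP : SatisfiesEstimates X f P) (k : ℕ) :
    P.M (k + 1) ≤ 2 * (P.κ * P.K₀) * P.M k ^ 2 := by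
  have h1 : P.M (k + 1) ≤ 2 * P.K k * P.M k := by
    zify
    linarith [hP.M_upper k]
  calc P.M (k + 1) ≤ 2 * P.K k * P.M k := h1
    _ ≤ 2 * (P.κ * P.K₀ * P.M k) * P.M k := by gcongr; exact K_le hP k
    _ = _ := by ring

theorem K_mul_M_succ_le (hP : SatisfiesEstimates X f P) (k : ℕ) :
    P.K (k + 1) * P.M (k + 1) ≤ 2 * (P.κ * P.K₀) ^ 2 * P.κ * P.M k ^ 3 := by
  calc P.K (k + 1) * P.M (k + 1) = P.κ * P.K k * P.M (k + 1) := by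
        simp only [Constants.K, pow_succ]; ring
    _ ≤ P.κ * (P.κ * P.K₀ * P.M k) * (2 * (P.κ * P.K₀) * P.M k ^ 2) := by
        gcongr
        · exact K_le hP k
        · exact M_succ_le hP k
    _ = _ := by ring

theorem tendsto_M_real (hP : SatisfiesEstimates X f P) :
    Tendsto (fun k => (P.M k : ℝ)) atTop atTop :=
  tendsto_natCast_atTop_atTop.comp (tendsto_M hP)

theorem tendsto_K_real (hP : SatisfiesEstimates X f P) :
    Tendsto (fun k => (P.K k : ℝ)) atTop atTop := by
  refine tendsto_natCast_atTop_atTop.comp (tendsto_atTop_mono (f := fun k => k) (fun k => ?_)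
    tendsto_id)
  have h1 : k < P.κ ^ k := Nat.lt_pow_self hP.two_le_κ
  exact h1.le.trans (Nat.le_mul_of_pos_left _ hP.one_le_K₀)

theorem tendsto_rpow_mul_decay (hP : SatisfiesEstimates X f P) {s : ℝ} (hs : 0 < s) (t : ℝ) :
    Tendsto (fun k => (P.M k : ℝ) ^ t * P.α ^ (-(s * P.M k))) atTop (𝓝 0) := by
  have hl : 0 < Real.log P.α := Real.log_pos hP.one_lt_α
  refine ((tendsto_rpow_mul_exp_neg_mul_atTop_nhds_zero t (s * Real.log P.α)
    (mul_pos hs hl)).comp (tendsto_M_real hP)).congr fun k => ?_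
  simp only [Function.comp]
  rw [Real.rpow_def_of_pos hP.α_pos]
  congr 2
  ring

theorem summable_pow_mul_decay (hP : SatisfiesEstimates X f P) {s : ℝ} (hs : 0 < s) (t : ℕ) :
    Summable (fun k => (P.M k : ℝ) ^ t * P.α ^ (-(s * P.M k))) := by
  have hα := hP.one_lt_α
  have h0 : 0 < P.α ^ (-s) := Real.rpow_pos_of_pos hP.α_pos _
  have h1 : ‖P.α ^ (-s)‖ < 1 := by
    rw [Real.norm_of_nonneg h0.le]
    exact Real.rpow_lt_one_of_one_lt_of_neg hα (by linarith)
  refine ((summable_pow_mul_geometric_of_norm_lt_one t h1).comp_injective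
    (M_strictMono hP).injective).congr fun k => ?_
  simp only [Function.comp]
  rw [← Real.rpow_natCast (P.α ^ (-s)), ← Real.rpow_mul hP.α_pos.le]
  congr 2
  ring

/-- The scale below which points that avoid the critical regions of level above `j` are sought. -/
noncomputable def scale (P : Constants d) (j : ℕ) : ℝ :=
  P.α ^ (-(P.b / (4 * P.p * d) * P.M j))

theorem scale_rate_pos (hd : 0 < d) (hP : SatisfiesEstimates X f P) :
    0 < P.b / (4 * P.p * d) := by
  have := b_pos hP
  have := p_pos hP
  have : (0 : ℝ) < d := by exact_mod_cast hd
  positivity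

theorem scale_pos (hP : SatisfiesEstimates X f P) (j : ℕ) : 0 < scale P j :=
  Real.rpow_pos_of_pos hP.α_pos _

theorem tendsto_scale (hd : 0 < d) (hP : SatisfiesEstimates X f P) :
    Tendsto (scale P) atTop (𝓝 0) := by
  refine (tendsto_rpow_mul_decay hP (scale_rate_pos hd hP) 0).congr fun k => ?_
  rw [Real.rpow_zero, one_mul, scale]

theorem scale_antitone (hd : 0 < d) (hP : SatisfiesEstimates X f P) : Antitone (scale P) := by
  intro i j hij
  refine Real.rpow_le_rpow_of_exponent_le hP.one_lt_α.le ?_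
  have h1 : (P.M i : ℝ) ≤ P.M j := by exact_mod_cast (M_strictMono hP).monotone hij
  have := mul_le_mul_of_nonneg_left h1 (scale_rate_pos hd hP).le
  linarith

/-! ### Points that avoid the critical regions of high level -/

theorem leb_visit_le (hd : 0 < d) (hR : SlowRecurrence ω f P) {i : ℕ}
    (hE : CondE ω f P i) (l : ℕ) :
    leb d {θ | θ - (l : ℤ) • ω ∈ critRegion ω f P i} ≤ ENNReal.ofReal (2 * P.ε i) := by
  obtain ⟨q, hq⟩ := hR.nonempty i
  refine (measure_mono fun θ hθ => ?_).trans (leb_closedBall_le hd (q + (l : ℤ) • ω) (P.ε i))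
  have hbdd : Bornology.IsBounded (critRegion ω f P i) :=
    isCompact_univ.isBounded.subset (subset_univ _)
  have h1 : dist θ (q + (l : ℤ) • ω) = dist (θ - (l : ℤ) • ω) q := by
    rw [dist_eq_norm, dist_eq_norm]
    congr 1
    abel
  rw [Metric.mem_closedBall, h1]
  exact (Metric.dist_le_diam_of_mem hbdd hθ hq).trans (le_of_lt hE)

/-- The total measure of the translates of the critical regions of level above `j`, relative to the
measure of a ball with radius `scale P j`, tends to zero. -/
theorem eventually_tsum_lt (hd : 0 < d) (hP : SatisfiesEstimates X f P) :
    ∀ᶠ j in atTop, ∑' k, ENNReal.ofReal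
        (((2 * P.K (j + k + 1) * P.M (j + k + 1) : ℕ) : ℝ) * (2 * P.ε (j + k + 1))) <
      ENNReal.ofReal ((scale P j / 2 / d) ^ d) := by
  have hd0 : (0 : ℝ) < d := by exact_mod_cast hd
  have hα := hP.one_lt_α
  have hα0 := hP.α_pos
  have hp := p_pos hP
  have hb := b_pos hP
  set a := P.b / (2 * P.p) with ha
  have ha0 : 0 < a := by positivity
  set τ : ℕ → ℝ := fun k => (P.M k : ℝ) ^ 3 * P.α ^ (-(a / 2 * P.M k)) with hτ
  have hτsum : Summable τ := summable_pow_mul_decay hP (by positivity) 3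
  have hτ0 : ∀ k, 0 ≤ τ k := fun k => mul_nonneg (by positivity) (Real.rpow_nonneg hα0.le _)
  set A : ℝ := 8 * ((P.κ * P.K₀ : ℕ) : ℝ) ^ 2 * P.κ * P.c₀ with hA
  have hA0 : 0 ≤ A := by have := hP.c₀_pos; positivity
  have htail : Tendsto (fun j => A * ∑' k, τ (k + j)) atTop (𝓝 0) := by
    simpa using (tendsto_sum_nat_add τ).const_mul A
  have hpos : (0 : ℝ) < (1 / (2 * d)) ^ d := by positivity
  filter_upwards [htail.eventually_lt_const hpos] with j hj
  have hdecay0 : 0 < P.α ^ (-(a / 2 * P.M j)) := Real.rpow_pos_of_pos hα0 _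
  have hterm : ∀ k, ((2 * P.K (j + k + 1) * P.M (j + k + 1) : ℕ) : ℝ) * (2 * P.ε (j + k + 1)) ≤
      P.α ^ (-(a / 2 * P.M j)) * (A * τ (k + j)) := by
    intro k
    rw [add_comm k j]
    have h1 : ((P.K (j + k + 1) * P.M (j + k + 1) : ℕ) : ℝ) ≤
        2 * ((P.κ * P.K₀ : ℕ) : ℝ) ^ 2 * P.κ * (P.M (j + k) : ℝ) ^ 3 := by
      exact_mod_cast K_mul_M_succ_le hP (j + k)
    -- The decay of `ε` is split in half: one factor is at most the `d`-th power of `scale P j`, the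
    -- other absorbs the cubic growth and makes the series converge to a small tail.
    have h2 : P.ε (j + k + 1) = P.c₀ * (P.α ^ (-(a / 2 * P.M (j + k))) *
        P.α ^ (-(a / 2 * P.M (j + k)))) := by
      rw [Constants.ε, ← Real.rpow_add hα0, Constants.Mpred, ha]
      congr 2
      ring
    have h3 : P.α ^ (-(a / 2 * P.M (j + k))) ≤ P.α ^ (-(a / 2 * P.M j)) := by
      refine Real.rpow_le_rpow_of_exponent_le hα.le ?_
      have : (P.M j : ℝ) ≤ P.M (j + k) := by
        exact_mod_cast (M_strictMono hP).monotone (Nat.le_add_right j k)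
      have := mul_le_mul_of_nonneg_left this (by positivity : 0 ≤ a / 2)
      linarith
    have h4 : 0 ≤ P.α ^ (-(a / 2 * P.M (j + k))) := Real.rpow_nonneg hα0.le _
    have hc0 := hP.c₀_pos
    rw [h2]
    simp only [hτ, hA]
    set y := P.α ^ (-(a / 2 * P.M (j + k)))
    calc ((2 * P.K (j + k + 1) * P.M (j + k + 1) : ℕ) : ℝ) * (2 * (P.c₀ * (y * y)))
        = ((P.K (j + k + 1) * P.M (j + k + 1) : ℕ) : ℝ) * (4 * P.c₀ * (y * y)) := by
          push_cast; ring
      _ ≤ 2 * ((P.κ * P.K₀ : ℕ) : ℝ) ^ 2 * P.κ * (P.M (j + k) : ℝ) ^ 3 *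
          (4 * P.c₀ * (P.α ^ (-(a / 2 * P.M j)) * y)) := by gcongr
      _ = _ := by ring
  have hsum : Summable fun k => P.α ^ (-(a / 2 * P.M j)) * (A * τ (k + j)) :=
    (((summable_nat_add_iff j).2 hτsum).mul_left A).mul_left _
  calc ∑' k, ENNReal.ofReal
        (((2 * P.K (j + k + 1) * P.M (j + k + 1) : ℕ) : ℝ) * (2 * P.ε (j + k + 1)))
      ≤ ∑' k, ENNReal.ofReal (P.α ^ (-(a / 2 * P.M j)) * (A * τ (k + j))) :=
        ENNReal.tsum_le_tsum fun k => ENNReal.ofReal_le_ofReal (hterm k)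
    _ = ENNReal.ofReal (∑' k, P.α ^ (-(a / 2 * P.M j)) * (A * τ (k + j))) :=
        (ENNReal.ofReal_tsum_of_nonneg
          (fun k => mul_nonneg hdecay0.le (mul_nonneg hA0 (hτ0 _))) hsum).symm
    _ = ENNReal.ofReal (P.α ^ (-(a / 2 * P.M j)) * (A * ∑' k, τ (k + j))) := by
        rw [tsum_mul_left, tsum_mul_left]
    _ < ENNReal.ofReal (P.α ^ (-(a / 2 * P.M j)) * (1 / (2 * d)) ^ d) := by
        rw [ENNReal.ofReal_lt_ofReal_iff (by positivity)]
        exact mul_lt_mul_of_pos_left hj hdecay0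
    _ = ENNReal.ofReal ((scale P j / 2 / d) ^ d) := by
        have h1 : scale P j / 2 / d = scale P j * (1 / (2 * d)) := by rw [div_div]; ring
        have h2 : scale P j ^ d = P.α ^ (-(a / 2 * P.M j)) := by
          rw [scale, ← Real.rpow_natCast, ← Real.rpow_mul hα0.le, ha]
          congr 1
          field_simp
          ring
        rw [h1, mul_pow, h2]

/-- Every set of full measure contains points close to `θ`, in a given ball that has `θ` in its
closure, whose recent past avoids the critical regions of level above `j`. -/
theorem eventually_exists_avoiding (hd : 0 < d) (hP : SatisfiesEstimates X f P)
    (hR : SlowRecurrence ω f P) (hE : ∀ n ≥ 1, CondE ω f P n) {θ θ₀ : Torus d} {r : ℝ} (hr : 0 < r)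
    (hθ : θ ∈ closure (Metric.ball θ₀ r)) {G : Torus d → Prop} (hG : ∀ᵐ x ∂leb d, G x) :
    ∀ᶠ j in atTop, ∃ θ' ∈ Metric.ball θ₀ r, G θ' ∧ dist θ' θ < scale P j ∧
      ∀ i > j, ∀ l : ℕ, 1 ≤ l → l ≤ 2 * P.K i * P.M i →
        θ' - (l : ℤ) • ω ∉ critRegion ω f P i := by
  filter_upwards [eventually_tsum_lt hd hP, (tendsto_scale hd hP).eventually_lt_const hr,
    (tendsto_scale hd hP).eventually_lt_const one_pos] with j hj hjr hj1
  have hs := scale_pos hP j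
  obtain ⟨q, hq⟩ := exists_ball_subset hs (by linarith : scale P j ≤ 2 * r) hθ
  set B : Set (Torus d) := ⋃ k : ℕ, ⋃ l ∈ Finset.Icc 1 (2 * P.K (j + k + 1) * P.M (j + k + 1)),
    {θ' | θ' - (l : ℤ) • ω ∈ critRegion ω f P (j + k + 1)} with hB
  have hBm : leb d B ≤ ∑' k, ENNReal.ofReal
      (((2 * P.K (j + k + 1) * P.M (j + k + 1) : ℕ) : ℝ) * (2 * P.ε (j + k + 1))) := by
    refine (measure_iUnion_le _).trans (ENNReal.tsum_le_tsum fun k => ?_)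
    refine (measure_biUnion_finset_le _ _).trans ?_
    refine (Finset.sum_le_sum fun l _ => leb_visit_le hd hR (hE (j + k + 1) (by omega)) l).trans ?_
    rw [Finset.sum_const, Nat.card_Icc, Nat.add_sub_cancel, nsmul_eq_mul,
      ENNReal.ofReal_mul (Nat.cast_nonneg _), ENNReal.ofReal_natCast]
  have hlt : leb d B < leb d (Metric.ball q (scale P j / 2)) :=
    hBm.trans_lt (hj.trans_le (le_leb_ball hd q (by positivity) (by linarith)))
  have hex : ∃ x ∈ Metric.ball q (scale P j / 2), x ∉ B ∧ G x := by
    by_contra! hno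
    have hsub : Metric.ball q (scale P j / 2) ⊆ B ∪ {x | ¬ G x} := by
      intro x hx
      by_cases hxB : x ∈ B
      · exact Or.inl hxB
      · exact Or.inr (hno x hx hxB)
    have h1 := (measure_mono hsub).trans (measure_union_le (μ := leb d) _ _)
    rw [ae_iff.1 hG, add_zero] at h1
    exact absurd hlt (not_lt.2 h1)
  obtain ⟨x, hx, hxB, hxG⟩ := hex
  refine ⟨x, (hq hx).1, hxG, (hq hx).2, fun i hi l hl1 hl2 hmem => hxB ?_⟩
  obtain ⟨k, rfl⟩ : ∃ k, i = j + k + 1 := ⟨i - j - 1, by omega⟩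
  exact mem_iUnion.2 ⟨k, mem_biUnion (Finset.mem_coe.2 (Finset.mem_Icc.2 ⟨hl1, hl2⟩)) hmem⟩

end Approximation

/-! ### Approximation of the upper bounding graph from below, and uniqueness. -/

section Main

variable {d : ℕ} {ω : Torus d} {X : Set ℝ} {f : Torus d → ℝ → ℝ} {P : Constants d}

/-- The proportion of `M_j` which is the number of backward steps used for the comparison of the
upper bounding graph at two points with distance at most `scale P j`. -/
noncomputable def horizonRate (P : Constants d) : ℝ := min 1 (P.b / (4 * P.p * d) / (2 * P.p))

/-- The proportion of `M_j` during which the orbit may be in the `j`-th critical region. -/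
noncomputable def waitRate (P : Constants d) : ℝ := horizonRate P / (4 * (P.p ^ 2 + 2))

theorem horizonRate_pos (hd : 0 < d) (hP : SatisfiesEstimates X f P) : 0 < horizonRate P :=
  lt_min one_pos (div_pos (scale_rate_pos hd hP) (by have := p_pos hP; positivity))

theorem waitRate_pos (hd : 0 < d) (hP : SatisfiesEstimates X f P) : 0 < waitRate P :=
  div_pos (horizonRate_pos hd hP) (by positivity)

/-- The sum up to level `j` is at most `2 M_j`, whereas `M_{j+1} ≥ K_j M_j` with `K_j` unbounded. -/
theorem tendsto_sum_M_div (hP : SatisfiesEstimates X f P) :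
    Tendsto (fun j => (∑ k ∈ Finset.range j, (P.M k : ℝ)) / P.M j) atTop (𝓝 0) := by
  rw [← tendsto_add_atTop_iff_nat 1]
  refine squeeze_zero (fun j => by positivity) (fun j => ?_)
    (by simpa using (tendsto_K_real hP).inv_tendsto_atTop.const_mul 2)
  have h1 : (∑ k ∈ Finset.range (j + 1), (P.M k : ℝ)) ≤ 2 * P.M j := by
    exact_mod_cast sum_M_le hP j
  have h2 : (P.K j : ℝ) * P.M j ≤ P.M (j + 1) := by exact_mod_cast hP.M_lower j
  have hK : (0 : ℝ) < P.K j := by exact_mod_cast K_pos hP j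
  have hM : (0 : ℝ) < P.M (j + 1) := by
    exact_mod_cast (show 0 < P.M (j + 1) by have := two_le_M hP (j + 1); omega)
  change _ ≤ 2 * (P.K j : ℝ)⁻¹
  rw [div_le_iff₀ hM]
  calc _ ≤ 2 * (P.M j : ℝ) := h1
    _ = 2 * (P.K j : ℝ)⁻¹ * (P.K j * P.M j) := by field_simp
    _ ≤ _ := mul_le_mul_of_nonneg_left h2 (by positivity)

/-- The finite terms of the count and the waiting time are each allotted a quarter of the horizon
after multiplication by `p² + 2`; the other half absorbs rounding. -/
theorem eventually_mul_le_horizon (hd : 0 < d) (hP : SatisfiesEstimates X f P) :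
    ∀ᶠ j in atTop, (P.p ^ 2 + 2) *
        (3 * (∑ k ∈ Finset.range j, (P.M k : ℝ)) + ⌈waitRate P * P.M j⌉₊) ≤
      ⌊horizonRate P * P.M j⌋₊ := by
  have hσ := horizonRate_pos hd hP
  have hp2 : 0 < P.p ^ 2 + 2 := by positivity
  have hη : 0 < horizonRate P / (12 * (P.p ^ 2 + 2)) := by positivity
  filter_upwards [(tendsto_sum_M_div hP).eventually_le_const hη,
    (tendsto_M_real hP).eventually_ge_atTop (4 * (P.p ^ 2 + 3) / horizonRate P)] with j h1 h2
  have hM : (0 : ℝ) < P.M j := by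
    exact_mod_cast (show 0 < P.M j by have := two_le_M hP j; omega)
  rw [div_le_iff₀ hM] at h1
  rw [div_le_iff₀ hσ] at h2
  have h3 := (Nat.ceil_lt_add_one (mul_nonneg (waitRate_pos hd hP).le hM.le)).le
  have h4 := (Nat.lt_floor_add_one (horizonRate P * P.M j)).le
  have h5 : (P.p ^ 2 + 2) * (waitRate P * P.M j) = horizonRate P * P.M j / 4 := by
    rw [waitRate]; field_simp
  have h6 : (P.p ^ 2 + 2) * (3 * (horizonRate P / (12 * (P.p ^ 2 + 2)) * P.M j)) =
      horizonRate P * P.M j / 4 := by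
    field_simp; ring
  calc _ ≤ (P.p ^ 2 + 2) * (3 * (horizonRate P / (12 * (P.p ^ 2 + 2)) * P.M j) +
          (waitRate P * P.M j + 1)) := by gcongr
    _ = (P.p ^ 2 + 2) * (3 * (horizonRate P / (12 * (P.p ^ 2 + 2)) * P.M j)) +
          (P.p ^ 2 + 2) * (waitRate P * P.M j) + (P.p ^ 2 + 2) := by ring
    _ = horizonRate P * P.M j / 2 + (P.p ^ 2 + 2) := by rw [h5, h6]; ring
    _ ≤ _ := by nlinarith

/-- At small scales, points whose recent past avoids the critical regions have values of the upper
bounding graph that are not much smaller. -/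
theorem eventually_phiPlus_lt (hd : 0 < d) (hq : IsQpfMap ω X f) (hc : IsMonotoneConcave X f)
    (hP : SatisfiesEstimates X f P) (hR : SlowRecurrence ω f P)
    (hpos : ∀ n θ, 0 ≤ upper ω f n θ) {ε : ℝ} (hε : 0 < ε) :
    ∀ᶠ j in atTop, ∀ θ θ' : Torus d, dist θ' θ < scale P j →
      (∀ i > j, ∀ l : ℕ, 1 ≤ l → l ≤ 2 * P.K i * P.M i →
        θ' - (l : ℤ) • ω ∉ critRegion ω f P i) →
      (∀ h : ℕ, ⌈waitRate P * P.M j⌉₊ ≤ h → h ≤ ⌊horizonRate P * P.M j⌋₊ + P.M j + 1 →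
        θ' - (h : ℤ) • ω ∉ critRegion ω f P j) →
      phiPlus ω f θ - ε < phiPlus ω f θ' := by
  have hα := hP.one_lt_α
  have hα0 := hP.α_pos
  have hp := p_pos hP
  have hσ := horizonRate_pos hd hP
  have hβ := scale_rate_pos hd hP
  set σ := horizonRate P with hσdef
  set β := P.b / (4 * P.p * d) with hβdef
  have lim1 : Tendsto (fun j => P.α ^ (-(σ / (4 * P.p) * P.M j))) atTop (𝓝 0) := by
    simpa only [Real.rpow_zero, one_mul] using
      tendsto_rpow_mul_decay hP (by positivity : 0 < σ / (4 * P.p)) 0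
  have lim2 : Tendsto (fun j => P.S * ((P.M j : ℝ) * P.α ^ (-(β / 2 * P.M j)))) atTop (𝓝 0) := by
    simpa only [Real.rpow_one, mul_zero] using
      (tendsto_rpow_mul_decay hP (by positivity : 0 < β / 2) 1).const_mul P.S
  have lim := lim1.add lim2
  rw [add_zero] at lim
  filter_upwards [lim.eventually_lt_const hε, eventually_mul_le_horizon hd hP,
    (tendsto_M_real hP).eventually_ge_atTop (2 / σ)] with j hj hN hMσ θ θ' hdist hav hnb
  have hM : (0 : ℝ) < P.M j := by
    exact_mod_cast (show 0 < P.M j by have := two_le_M hP j; omega)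
  set N := ⌊σ * P.M j⌋₊ with hNdef
  have hNle : (N : ℝ) ≤ σ * P.M j := Nat.floor_le (by positivity)
  have hNM : (N : ℝ) ≤ P.M j := by
    have : σ ≤ 1 := min_le_left _ _
    nlinarith
  have hNge : σ * P.M j / 2 ≤ N := by
    rw [div_le_iff₀ hσ] at hMσ
    have := (Nat.lt_floor_add_one (σ * P.M j)).le
    rw [← hNdef] at this
    linarith
  have hcard := card_low_le hq hc hP hR hpos θ' j N _ (by exact_mod_cast hNM) hav hnb
  have hmain := phiPlus_sub_le hq hc hP hpos θ θ' N
  set B := (((Finset.Icc 1 N).filter fun n : ℕ => phiPlus ω f (θ' - (n : ℤ) • ω) < P.c).card : ℝ)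
  -- Contraction wins if `(p² + 2) B < 2N`. The proportional part of the count contributes at most
  -- `N / 2`, since `(p² + 2)/(p² + 1) ≤ 4/3`, and the remaining part at most `N`.
  have hexp : -(2 / P.p) * N + (P.p + 2 / P.p) * B ≤ -(σ / (4 * P.p) * P.M j) := by
    have e1 : (P.p ^ 2 + 2) * (3 / 8 * N * (1 / (P.p ^ 2 + 1))) ≤ N / 2 := by
      have h1 : (P.p ^ 2 + 2) * (3 / 8 * N * (1 / (P.p ^ 2 + 1))) =
          3 / 8 * N * ((P.p ^ 2 + 2) / (P.p ^ 2 + 1)) := by ring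
      have h2 : (P.p ^ 2 + 2) / (P.p ^ 2 + 1) ≤ 4 / 3 := by
        rw [div_le_div_iff₀ (by positivity) (by norm_num)]
        linarith [p_sq_ge hP]
      rw [h1]
      calc 3 / 8 * (N : ℝ) * ((P.p ^ 2 + 2) / (P.p ^ 2 + 1)) ≤ 3 / 8 * (N : ℝ) * (4 / 3) := by gcongr
        _ = N / 2 := by ring
    have e2 : (P.p ^ 2 + 2) * B ≤ 3 / 2 * N := by
      have := mul_le_mul_of_nonneg_left hcard (by positivity : 0 ≤ P.p ^ 2 + 2)
      rw [add_assoc, mul_add] at this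
      linarith
    have e3 : -(2 / P.p) * N + (P.p + 2 / P.p) * B = (-2 * N + (P.p ^ 2 + 2) * B) / P.p := by
      field_simp
    rw [e3, div_le_iff₀ hp]
    have e4 : -(σ / (4 * P.p) * P.M j) * P.p = -(σ * P.M j / 4) := by field_simp
    rw [e4]
    linarith
  have t1 := Real.rpow_le_rpow_of_exponent_le hα.le hexp
  have t2 : N * (P.S * dist θ θ') * (P.α ^ P.p) ^ N ≤
      P.S * ((P.M j : ℝ) * P.α ^ (-(β / 2 * P.M j))) := by
    -- The second bound in `horizonRate` limits the amplification of the initial distance to the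
    -- inverse square root of `scale P j`.
    have h1 : (P.α ^ P.p) ^ N ≤ P.α ^ (β / 2 * P.M j) := by
      rw [← Real.rpow_natCast, ← Real.rpow_mul hα0.le]
      refine Real.rpow_le_rpow_of_exponent_le hα.le ?_
      have h2 : σ ≤ β / (2 * P.p) := min_le_right _ _
      calc P.p * N ≤ P.p * (β / (2 * P.p) * P.M j) := by
            gcongr
            exact hNle.trans (by gcongr)
        _ = _ := by field_simp
    have h3 : scale P j = P.α ^ (-(β / 2 * P.M j)) * P.α ^ (-(β / 2 * P.M j)) := by
      rw [scale, ← Real.rpow_add hα0]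
      congr 1
      ring
    have h4 : P.α ^ (-(β / 2 * P.M j)) * P.α ^ (β / 2 * P.M j) = 1 := by
      rw [← Real.rpow_add hα0, neg_add_cancel, Real.rpow_zero]
    have hS := hP.S_pos
    have hs0 := scale_pos hP j
    have hMS : 0 ≤ (P.M j : ℝ) * (P.S * scale P j) := by positivity
    rw [dist_comm] at hdist
    calc N * (P.S * dist θ θ') * (P.α ^ P.p) ^ N
        ≤ P.M j * (P.S * scale P j) * P.α ^ (β / 2 * P.M j) := by
          gcongr
      _ = P.S * (P.M j * (P.α ^ (-(β / 2 * P.M j)) *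
          (P.α ^ (-(β / 2 * P.M j)) * P.α ^ (β / 2 * P.M j)))) := by rw [h3]; ring
      _ = _ := by rw [h4, mul_one]
  linarith

/-- Nearby points cannot visit the critical regions of two consecutive high levels at times that are
comparable with the respective waiting times. -/
theorem eventually_not_both_visit (hd : 0 < d) (hω : Diophantine ω)
    (hP : SatisfiesEstimates X f P) (hE : ∀ n ≥ 1, CondE ω f P n) :
    ∀ᶠ j in atTop, ∀ (θ₁ θ₂ : Torus d) (h₁ h₂ : ℕ), dist θ₁ θ₂ < 2 * scale P (j + 1) →
      h₁ ≤ 2 * P.M (j + 1) + 1 → waitRate P * P.M (j + 2) ≤ h₂ → h₂ ≤ 2 * P.M (j + 2) + 1 →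
      θ₁ - (h₁ : ℤ) • ω ∈ critRegion ω f P (j + 1) →
      θ₂ - (h₂ : ℤ) • ω ∉ critRegion ω f P (j + 2) := by
  obtain ⟨C, η, hC, hη, hdio⟩ := hω
  have hρ := waitRate_pos hd hP
  have hα := hP.one_lt_α
  have hα0 := hP.α_pos
  have hp := p_pos hP
  have hb := b_pos hP
  have hc0 := hP.c₀_pos
  set Q : ℝ := ((P.κ * P.K₀ : ℕ) : ℝ) with hQ
  have hQ0 : 0 ≤ Q := Nat.cast_nonneg _
  have lim : Tendsto (fun j => ((24 * Q ^ 3) ^ η * (P.c₀ + 2)) *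
      ((P.M j : ℝ) ^ (4 * η) * scale P j)) atTop (𝓝 0) := by
    have := (tendsto_rpow_mul_decay hP (scale_rate_pos hd hP) (4 * η)).const_mul
      ((24 * Q ^ 3) ^ η * (P.c₀ + 2))
    rw [mul_zero] at this
    exact this
  filter_upwards [lim.eventually_lt_const hC,
    ((tendsto_add_atTop_iff_nat 1).2 (tendsto_K_real hP)).eventually_ge_atTop (3 / waitRate P)]
    with j hj hK θ₁ θ₂ h₁ h₂ hdist hh₁ hh₂ hh₂' hm₁ hm₂
  have hM1 := two_le_M hP (j + 1)
  have hM2 := two_le_M hP (j + 2)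
  -- the second visit is later
  have hlt : h₁ < h₂ := by
    have h1 : (P.K (j + 1) : ℝ) * P.M (j + 1) ≤ P.M (j + 2) := by
      exact_mod_cast hP.M_lower (j + 1)
    rw [div_le_iff₀ hρ] at hK
    have h2 : (3 : ℝ) * P.M (j + 1) ≤ h₂ := by
      calc (3 : ℝ) * P.M (j + 1) ≤ P.K (j + 1) * waitRate P * P.M (j + 1) := by gcongr
        _ = waitRate P * (P.K (j + 1) * P.M (j + 1)) := by ring
        _ ≤ waitRate P * P.M (j + 2) := by gcongr
        _ ≤ h₂ := hh₂
    have h3 : 3 * P.M (j + 1) ≤ h₂ := by exact_mod_cast h2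
    omega
  set n : ℤ := (h₂ : ℤ) - h₁ with hn
  have hn0 : 0 < n := by omega
  have hn1 : n ≤ 3 * P.M (j + 2) := by omega
  -- By nestedness both visits are to the same small region, so `n = h₂ - h₁` is a close return of
  -- the rotation.
  have hm₂' : θ₂ - (h₂ : ℤ) • ω ∈ critRegion ω f P (j + 1) :=
    critRegion_antitone hP (Nat.le_succ _) hm₂
  have hbdd : Bornology.IsBounded (critRegion ω f P (j + 1)) :=
    isCompact_univ.isBounded.subset (subset_univ _)
  have hdiam : dist (θ₁ - (h₁ : ℤ) • ω) (θ₂ - (h₂ : ℤ) • ω) < P.ε (j + 1) :=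
    (Metric.dist_le_diam_of_mem hbdd hm₁ hm₂').trans_lt (hE (j + 1) (by omega))
  have hnorm : dist (n • ω) 0 ≤ P.ε (j + 1) + 2 * scale P (j + 1) := by
    have h1 : n • ω = (θ₁ - (h₁ : ℤ) • ω - (θ₂ - (h₂ : ℤ) • ω)) - (θ₁ - θ₂) := by
      rw [hn, sub_smul]; abel
    rw [dist_zero_right, h1]
    rw [dist_eq_norm] at hdiam hdist
    exact (norm_sub_le _ _).trans (add_le_add hdiam.le hdist.le)
  have hεs : P.ε (j + 1) ≤ P.c₀ * scale P j := by
    rw [Constants.ε, Constants.Mpred, scale]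
    refine mul_le_mul_of_nonneg_left (Real.rpow_le_rpow_of_exponent_le hα.le ?_) hc0.le
    have hd1 : (1 : ℝ) ≤ d := by exact_mod_cast hd
    have h1 : P.b / (4 * P.p * d) ≤ P.b / (2 * P.p) := by
      refine div_le_div_of_nonneg_left hb.le (by positivity) ?_
      nlinarith
    have h2 : P.M j * P.b / (2 * P.p) = P.b / (2 * P.p) * P.M j := by ring
    rw [h2]
    have := mul_le_mul_of_nonneg_right h1 (Nat.cast_nonneg (α := ℝ) (P.M j))
    linarith
  have hss : scale P (j + 1) ≤ scale P j := scale_antitone hd hP (Nat.le_succ j)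
  have hgrow : (n : ℝ) ≤ 24 * Q ^ 3 * (P.M j : ℝ) ^ 4 := by
    have h1 : (P.M (j + 2) : ℝ) ≤ 2 * Q * (P.M (j + 1) : ℝ) ^ 2 := by
      rw [hQ]
      exact_mod_cast M_succ_le hP (j + 1)
    have h2 : (P.M (j + 1) : ℝ) ≤ 2 * Q * (P.M j : ℝ) ^ 2 := by
      rw [hQ]
      exact_mod_cast M_succ_le hP j
    have h3 : (n : ℝ) ≤ 3 * P.M (j + 2) := by exact_mod_cast hn1
    calc (n : ℝ) ≤ 3 * P.M (j + 2) := h3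
      _ ≤ 3 * (2 * Q * (2 * Q * (P.M j : ℝ) ^ 2) ^ 2) := by
          refine mul_le_mul_of_nonneg_left (h1.trans ?_) (by norm_num)
          gcongr
      _ = _ := by ring
  have hnr : (0 : ℝ) < n := by exact_mod_cast hn0
  have hd2 := (hdio n hn0.ne').trans hnorm
  rw [abs_of_pos hnr, Real.rpow_neg hnr.le, ← div_eq_mul_inv,
    div_le_iff₀ (Real.rpow_pos_of_pos hnr _)] at hd2
  refine absurd hj (not_lt.2 (hd2.trans ?_))
  have hs0 := scale_pos hP j
  calc (P.ε (j + 1) + 2 * scale P (j + 1)) * (n : ℝ) ^ η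
      ≤ (P.c₀ * scale P j + 2 * scale P j) * (24 * Q ^ 3 * (P.M j : ℝ) ^ 4) ^ η := by
        gcongr
    _ = _ := by
        rw [Real.mul_rpow (by positivity) (by positivity), Real.rpow_mul (Nat.cast_nonneg _) 4 η]
        norm_num
        ring

/-- The value of the upper bounding graph at a point in the closure of a ball is approximated from
below by its values at points of the ball in any given set of full measure. -/
theorem exists_phiPlus_lt (hω : Diophantine ω) (hq : IsQpfMap ω X f) (hc : IsMonotoneConcave X f)
    (hP : SatisfiesEstimates X f P) (hR : SlowRecurrence ω f P) (hE : ∀ n ≥ 1, CondE ω f P n)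
    (hpos : ∀ n θ, 0 ≤ upper ω f n θ) {θ θ₀ : Torus d} {r : ℝ} (hr : 0 < r)
    (hθ : θ ∈ closure (Metric.ball θ₀ r)) {G : Torus d → Prop} (hG : ∀ᵐ x ∂leb d, G x)
    {ε : ℝ} (hε : 0 < ε) :
    ∃ θ' ∈ Metric.ball θ₀ r, G θ' ∧ dist θ' θ < ε ∧ phiPlus ω f θ - ε < phiPlus ω f θ' := by
  have hd := hω.pos_dim
  by_contra! hno
  -- If no good point exists, then at every high level the point avoiding the higher regions must
  -- make a late visit to level `j`. Two consecutive levels then contradict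
  -- `eventually_not_both_visit`.
  have key : ∀ᶠ j in atTop, ∃ (θ' : Torus d) (h : ℕ), dist θ' θ < scale P j ∧
      waitRate P * P.M j ≤ h ∧ h ≤ 2 * P.M j + 1 ∧ θ' - (h : ℤ) • ω ∈ critRegion ω f P j := by
    filter_upwards [eventually_exists_avoiding hd hP hR hE hr hθ hG,
      eventually_phiPlus_lt hd hq hc hP hR hpos hε,
      (tendsto_scale hd hP).eventually_lt_const hε] with j h1 h2 h3
    obtain ⟨θ', hB, hG', hdist, hav⟩ := h1
    by_contra! hcon
    refine absurd (h2 θ θ' hdist hav fun h hh1 hh2 => ?_)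
      (not_lt.2 (hno θ' hB hG' (hdist.trans h3)))
    have hN : ⌊horizonRate P * P.M j⌋₊ ≤ P.M j := by
      refine Nat.floor_le_of_le ?_
      exact mul_le_of_le_one_left (Nat.cast_nonneg _) (min_le_left _ _)
    exact hcon θ' h hdist (Nat.ceil_le.1 hh1) (by omega)
  obtain ⟨j, ⟨hj1, hj2⟩, hj3⟩ := (((tendsto_add_atTop_nat 1).eventually key).and
    ((tendsto_add_atTop_nat 2).eventually key)).and
      (eventually_not_both_visit hd hω hP hE) |>.exists
  obtain ⟨θ₁, h₁, hd₁, -, hh₁, hm₁⟩ := hj1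
  obtain ⟨θ₂, h₂, hd₂, hw₂, hh₂, hm₂⟩ := hj2
  refine hj3 θ₁ θ₂ h₁ h₂ ?_ hh₁ hw₂ hh₂ hm₁ hm₂
  have h1 := dist_triangle_right θ₁ θ₂ θ
  have h2 := scale_antitone hd hP (Nat.le_succ (j + 1))
  have h3 : scale P (j + 1).succ = scale P (j + 2) := rfl
  linarith

/-! ### Comparison of semi-continuous invariant graphs. -/

/-- An upper semi-continuous function whose superlevel set `{φ ≥ t}` has full measure is bounded
below by `t`. -/
theorem le_of_ae_le (hd : 0 < d) {φ : Torus d → ℝ} (hφ : UpperSemicontinuous φ) {t : ℝ}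
    (h : ∀ᵐ θ ∂leb d, t ≤ φ θ) (θ : Torus d) : t ≤ φ θ := by
  by_contra! hlt
  obtain ⟨s, hs, hball⟩ := Metric.isOpen_iff.1 (hφ.isOpen_preimage t) θ hlt
  have h1 : leb d (Metric.ball θ (min s 1)) = 0 := by
    refine measure_mono_null (fun x hx => ?_) (ae_iff.1 h)
    exact not_le.2 (hball (Metric.ball_subset_ball (min_le_left _ _) hx))
  have h2 := le_leb_ball hd θ (lt_min hs one_pos) (min_le_right _ _)
  rw [h1, nonpos_iff_eq_zero, ENNReal.ofReal_eq_zero] at h2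
  have : (0 : ℝ) < d := by exact_mod_cast hd
  have : 0 < (min s 1 / d) ^ d := by
    have := lt_min hs one_pos
    positivity
  linarith

/-- The line `x = 1` is not invariant. -/
theorem exists_map_one_ne (hq : IsQpfMap ω X f) (hc : IsMonotoneConcave X f)
    (hP : SatisfiesEstimates X f P) (hR : SlowRecurrence ω f P) : ∃ θ, f θ 1 ≠ 1 := by
  by_contra! hone
  -- If 1 is fixed in every fibre, contraction towards it keeps `C` invariant, so no orbit could go
  -- from `C` to `E` as a point of the region of level 1 requires.
  have hC : ∀ θ, ∀ x ∈ P.C, f θ x ∈ P.C := by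
    intro θ x hx
    have h1 := hP.lip_C θ 1 (one_mem_C hP) x hx
    rw [hone θ] at h1
    have h2 : P.α ^ (-(2 / P.p)) ≤ 1 := by
      refine Real.rpow_le_one_of_one_le_of_nonpos hP.one_lt_α.le ?_
      have := p_pos hP
      have : 0 < 2 / P.p := by positivity
      linarith
    have h3 : |1 - f θ x| ≤ 1 - x := by
      refine h1.trans ?_
      rw [abs_of_nonneg (by linarith [hx.2] : (0 : ℝ) ≤ 1 - x)]
      exact mul_le_of_le_one_left (by linarith [hx.2]) h2
    exact ⟨by linarith [le_abs_self (1 - f θ x), hx.1],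
      map_le_one hq hc θ (C_subset hq hP hx) hx.2⟩
  have hit : ∀ (n : ℕ) θ, ∀ x ∈ P.C, iter ω f n θ x ∈ P.C := by
    intro n θ x hx
    induction n with
    | zero => exact hx
    | succ n ih => rw [iter_succ]; exact hC _ _ ih
  obtain ⟨θ, hθ⟩ := hR.nonempty 1
  obtain ⟨-, x, hx, hE⟩ := (mem_critRegion_succ hP).1 hθ
  have h1 := (hit (P.M 0 + 1) θ _ (hit (P.M 0 - 1) (θ - (P.M 0 - 1) • ω) x hx)).1
  have h2 := hE.2
  have := hP.e_lt_c
  linarith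

/-- An upper semi-continuous invariant graph that agrees with the upper bounding graph almost
everywhere is nowhere above the line `x = 1`. -/
theorem invariantGraph_le_one (hd : 0 < d) (hq : IsQpfMap ω X f) (hc : IsMonotoneConcave X f)
    (hP : SatisfiesEstimates X f P) (hR : SlowRecurrence ω f P)
    (hpos : ∀ n θ, 0 ≤ upper ω f n θ) {φ : Torus d → ℝ} (hφ : IsInvariantGraph ω X f φ)
    (husc : UpperSemicontinuous φ) (hae : φ =ᵐ[leb d] phiPlus ω f) (θ : Torus d) : φ θ ≤ 1 := by
  by_contra! hgt
  -- Values at most 1 stay so, hence the whole backward orbit lies above 1. It is dense and `{φ <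
  -- 1}` is open, so `φ ≥ 1` everywhere; this would make `φ⁺` identically 1.
  have hback : ∀ n : ℕ, 1 < φ (θ + n • (-ω)) := by
    intro n
    induction n with
    | zero => simpa using hgt
    | succ n ih =>
      by_contra! hle
      have h1 := hφ.invariant (θ + (n + 1) • (-ω))
      have h2 := map_le_one hq hc (θ + (n + 1) • (-ω)) (hφ.mem _) hle
      have h3 : θ + (n + 1) • (-ω) + ω = θ + n • (-ω) := by rw [succ_nsmul]; abel
      rw [h1, h3] at h2
      linarith
  have hge : ∀ ϑ, 1 ≤ φ ϑ := by
    by_contra! hlt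
    obtain ⟨k, hk⟩ := exists_nsmul_mem hq.totallyIrrational.neg θ (husc.isOpen_preimage 1) hlt
    exact absurd (hback k) (not_lt.2 (le_of_lt hk))
  have hge' : ∀ ϑ, 1 ≤ phiPlus ω f ϑ :=
    le_of_ae_le hd (upperSemicontinuous_phiPlus hpos hq hc hP) (by
      filter_upwards [hae] with ϑ h
      rw [← h]
      exact hge ϑ)
  have hone : ∀ ϑ, phiPlus ω f ϑ = 1 := fun ϑ =>
    le_antisymm (phiPlus_mem_Icc hpos hq hc hP ϑ).2 (hge' ϑ)
  obtain ⟨ϑ, hϑ⟩ := exists_map_one_ne hq hc hP hR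
  have := phiPlus_invariant hpos hq hc hP ϑ
  rw [hone, hone] at this
  exact hϑ this

/-- Semi-continuity of `φ` at `θ`, tested along points where `φ = φ⁺` and `φ⁺` is nearly as large as
at `θ`, gives `φ ≥ φ⁺`. Being then between 0 and 1, the invariant graph `φ` lies in `Λ`, hence below
`φ⁺`. -/
theorem invariantGraph_eq_phiPlus (hω : Diophantine ω) (hq : IsQpfMap ω X f)
    (hc : IsMonotoneConcave X f) (hP : SatisfiesEstimates X f P) (hR : SlowRecurrence ω f P)
    (hE : ∀ n ≥ 1, CondE ω f P n) (hpos : ∀ n θ, 0 ≤ upper ω f n θ) {φ : Torus d → ℝ}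
    (hφ : IsInvariantGraph ω X f φ) (husc : UpperSemicontinuous φ)
    (hae : φ =ᵐ[leb d] phiPlus ω f) : φ = phiPlus ω f := by
  have hle : ∀ θ, phiPlus ω f θ ≤ φ θ := by
    intro θ
    by_contra! hlt
    set t := (φ θ + phiPlus ω f θ) / 2 with ht
    obtain ⟨s, hs, hball⟩ := Metric.isOpen_iff.1 (husc.isOpen_preimage t) θ
      (show φ θ < t by linarith)
    obtain ⟨θ', -, h1, h2, h3⟩ := exists_phiPlus_lt hω hq hc hP hR hE hpos one_pos
      (subset_closure (Metric.mem_ball_self one_pos) : θ ∈ closure (Metric.ball θ 1)) hae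
      (lt_min hs (show 0 < phiPlus ω f θ - t by linarith))
    have h4 : φ θ' < t := hball (Metric.mem_ball.2 (h2.trans_le (min_le_left _ _)))
    have h5 := min_le_right s (phiPlus ω f θ - t)
    rw [h1] at h4
    linarith
  funext θ
  refine le_antisymm (le_phiPlus θ (mem_fibre_of_invariant (fun ϑ => ⟨?_, ?_⟩) hφ.invariant θ))
    (hle θ)
  · exact (phiPlus_mem_Icc hpos hq hc hP ϑ).1.trans (hle ϑ)
  · exact invariantGraph_le_one hω.pos_dim hq hc hP hR hpos hφ husc hae ϑ

/-- Upper semi-continuity bounds nearby values from above, and `exists_phiPlus_lt` supplies a point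
of the ball where they are not much smaller. -/
theorem phiPlus_image_closure_ball_subset (hω : Diophantine ω) (hq : IsQpfMap ω X f)
    (hc : IsMonotoneConcave X f) (hP : SatisfiesEstimates X f P) (hR : SlowRecurrence ω f P)
    (hE : ∀ n ≥ 1, CondE ω f P n) (hpos : ∀ n θ, 0 ≤ upper ω f n θ) (θ₀ : Torus d) {r : ℝ}
    (hr : 0 < r) :
    phiPlus ω f '' closure (Metric.ball θ₀ r) ⊆ closure (phiPlus ω f '' Metric.ball θ₀ r) := by
  rintro _ ⟨θ, hθ, rfl⟩
  refine Metric.mem_closure_iff.2 fun ε hε => ?_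
  obtain ⟨s, hs, hball⟩ := Metric.isOpen_iff.1
    ((upperSemicontinuous_phiPlus hpos hq hc hP).isOpen_preimage (phiPlus ω f θ + ε)) θ
    (show phiPlus ω f θ < phiPlus ω f θ + ε by linarith)
  obtain ⟨θ', hB, -, h2, h3⟩ := exists_phiPlus_lt hω hq hc hP hR hE hpos hr hθ
    (G := fun _ => True) (by simp) (lt_min hs hε)
  refine ⟨_, mem_image_of_mem _ hB, ?_⟩
  have h4 : phiPlus ω f θ' < phiPlus ω f θ + ε :=
    hball (Metric.mem_ball.2 (h2.trans_le (min_le_left _ _)))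
  have h5 := min_le_right s ε
  rw [Real.dist_eq, abs_lt]
  constructor <;> linarith

end Main

end QPF

theorem corollary4p3 {d : ℕ} (ω : QPF.Torus d) (hω : QPF.Diophantine ω)
    (X : Set ℝ) (f : QPF.Torus d → ℝ → ℝ) (hf : QPF.ClassV ω X f) :
    ((∀ θ, (QPF.fibre ω f θ).Nonempty) ∧
      QPF.IsInvariantGraph ω X f (QPF.phiPlus ω f) ∧
      UpperSemicontinuous (QPF.phiPlus ω f) ∧
      ∀ φ : QPF.Torus d → ℝ, QPF.IsInvariantGraph ω X f φ → UpperSemicontinuous φ →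
        φ =ᵐ[QPF.leb d] QPF.phiPlus ω f → φ = QPF.phiPlus ω f) ∧
    ∀ (θ : QPF.Torus d) (r : ℝ), 0 < r →
      QPF.phiPlus ω f '' closure (Metric.ball θ r) ⊆
        closure (QPF.phiPlus ω f '' Metric.ball θ r) := by
  obtain ⟨hq, hc, P, hP, hFE⟩ := hf
  have hR := QPF.slowRecurrence fun n hn => (hFE n hn).1
  have hE : ∀ n ≥ 1, QPF.CondE ω f P n := fun n hn => (hFE n hn).2
  have hpos := QPF.upper_nonneg hq hc hP hR.nonempty (QPF.tendsto_M hP)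
  exact ⟨⟨fun θ => ⟨_, QPF.mem_fibre_of_invariant (QPF.phiPlus_mem_Icc hpos hq hc hP)
      (QPF.phiPlus_invariant hpos hq hc hP) θ⟩,
    QPF.isInvariantGraph_phiPlus hpos hq hc hP, QPF.upperSemicontinuous_phiPlus hpos hq hc hP,
    fun φ hφ husc hae => QPF.invariantGraph_eq_phiPlus hω hq hc hP hR hE hpos hφ husc hae⟩,
    fun θ r hr => QPF.phiPlus_image_closure_ball_subset hω hq hc hP hR hE hpos θ hr⟩
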